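/- Let $m,n\ge 1$ be integers and let $\mathbb{Q}(\mu_m)$ be the $m$-th cyclotomic field. Let $(a_k)_{k\ge 0}$ be a linear recurrence sequence of dimension $n$ in $\mathbb{Q}(\mu_m)$, i.e. $a_k\in\mathbb{Q}(\mu_m)$ and there are constants $c_1,\dots,c_n\in\mathbb{Q}(\mu_m)$ with $c_n\ne 0$ and $a_k=\sum_{i=1}^n c_i a_{k-i}$ for all $k\ge n$. Define the positive integer $R_{m,n}$ as follows. If $m$ is odd, $R_{m,n}=R_{2m,n}$. If $m$ is even, $R_{m,1}=m$, and for $n>1$, $R_{m,n}=\prod_p p^{e_p}$ over all primes $p$, where $$e_p=\begin{cases}0,&p\nmid m,\ p>n+1;\\ 1+\lfloor\log_p\frac{n}{p-1}\rfloor,&p\nmid m,\ 2<p\le n+1;\\ 2+\lfloor\log_2 n\rfloor,&p=2,\ \operatorname{ord}_2(m)=1;\\ \operatorname{ord}_p(m)+\lfloor\log_p n\rfloor,&2p\mid m.\end{cases}$$ A sequence $(f_k)_{k\ge 0}$ is called virtually periodic if there are integers $N,r\ge 1$ with $f_k=f_{k+r}$ for all $k\ge N$; the minimal such $r$ is its virtual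 period and the minimal such $N$ its pre-period length. (1) There is a positive integer $s\mid R_{m,n}$ such that $\{k\ge 0: a_k=0\}$ is the union of a finite set and finitely many (possibly no) sets of the form $i+s\mathbb{N}$ with $i\ge 0$, where $\mathbb{N}=\{0,1,2,\dots\}$. (2) The sequence of fields $(\mathbb{Q}(a_k))_{k\ge 0}$ is virtually periodic and its virtual period $r$ divides $R_{m,n}$. Moreover, if $N$ is its pre-period length, then $\mathbb{Q}(a_k)\subseteq\mathbb{Q}(a_{k'})$ for all $k,k'\ge 0$ with $k\equiv k'\pmod r$ and $k'\ge N$. -/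

import Mathlib

namespace VirtualPeriod

/-- `a` is a linear recurrence sequence of dimension `n` in `K`: there are constants
`c 1, …, c n` in `K` with `c n ≠ 0` and `a k = ∑ i ∈ {1, …, n}, c i * a (k - i)` for all `k ≥ n`.
Mathlib's `LinearRecurrence` writes this as `a (k + n) = ∑ i < n, c (n - i) * a (k + i)`;
see `isLinearRecurrenceSeq_iff`. -/
def IsLinearRecurrenceSeq {K : Type*} [Field K] (n : ℕ) (a : ℕ → K) : Prop :=
  1 ≤ n ∧ ∃ c : ℕ → K, c n ≠ 0 ∧
    LinearRecurrence.IsSolution ⟨n, fun i : Fin n => c (n - (i : ℕ))⟩ a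

theorem isLinearRecurrenceSeq_iff {K : Type*} [Field K] (n : ℕ) (a : ℕ → K) :
    IsLinearRecurrenceSeq n a ↔ 1 ≤ n ∧ ∃ c : ℕ → K, c n ≠ 0 ∧
      ∀ k, n ≤ k → a k = ∑ i ∈ Finset.Icc 1 n, c i * a (k - i) := by
  have key : ∀ (c : ℕ → K) (k : ℕ),
      ∑ i : Fin n, c (n - (i : ℕ)) * a (k + i) =
        ∑ i ∈ Finset.Icc 1 n, c i * a (k + n - i) := by
    intro c k
    rw [Fin.sum_univ_eq_sum_range (fun i => c (n - i) * a (k + i)) n]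
    refine Finset.sum_bij' (fun i _ => n - i) (fun i _ => n - i) ?_ ?_ ?_ ?_ ?_
    · intro i hi; simp only [Finset.mem_range, Finset.mem_Icc] at *; omega
    · intro i hi; simp only [Finset.mem_range, Finset.mem_Icc] at *; omega
    · intro i hi; simp only [Finset.mem_range] at *; omega
    · intro i hi; simp only [Finset.mem_Icc] at *; omega
    · intro i hi
      simp only [Finset.mem_range] at hi
      rw [show k + n - (n - i) = k + i by omega]
  unfold IsLinearRecurrenceSeq
  refine and_congr_right fun _ => exists_congr fun c => and_congr_right fun _ => ?_
  unfold LinearRecurrence.IsSolution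
  constructor
  · intro h k hk
    obtain ⟨j, rfl⟩ := Nat.exists_eq_add_of_le' hk
    rw [← key]
    exact h j
  · intro h k
    exact (h (k + n) (Nat.le_add_left _ _)).trans (key c k).symm

/-- A sequence is virtually periodic if `f k = f (k + r)` for all `k ≥ N`, for some
`N, r ≥ 1`. -/
def IsVirtuallyPeriodic {α : Type*} (f : ℕ → α) : Prop :=
  ∃ N r : ℕ, 1 ≤ N ∧ 1 ≤ r ∧ ∀ k, N ≤ k → f k = f (k + r)

/-- The least `r` that occurs in `IsVirtuallyPeriodic`. -/
noncomputable def virtualPeriod {α : Type*} (f : ℕ → α) : ℕ :=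
  sInf {r : ℕ | ∃ N : ℕ, 1 ≤ N ∧ 1 ≤ r ∧ ∀ k, N ≤ k → f k = f (k + r)}

/-- The least `N` that occurs in `IsVirtuallyPeriodic`. -/
noncomputable def prePeriodLength {α : Type*} (f : ℕ → α) : ℕ :=
  sInf {N : ℕ | ∃ r : ℕ, 1 ≤ N ∧ 1 ≤ r ∧ ∀ k, N ≤ k → f k = f (k + r)}

/-- The exponent `e_p` of the prime `p`, for even `m` and `n ≥ 2`. The floors of the logarithms
are `Nat.log`; see `natLog_eq` and `natLog_div_eq`. -/
def expo (m n p : ℕ) : ℕ :=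
  if p ∣ m then
    if p = 2 ∧ padicValNat 2 m = 1 then 2 + Nat.log 2 n
    else padicValNat p m + Nat.log p n
  else if p ≤ n + 1 then 1 + Nat.log p (n / (p - 1))
  else 0

theorem natLog_eq (n p : ℕ) :
    (Nat.log p n : ℤ) = ⌊Real.logb (p : ℝ) (n : ℝ)⌋ := by
  rw [Real.floor_logb_natCast (Nat.cast_nonneg n), Int.log_natCast]

theorem natLog_div_eq (n p : ℕ) (hp : 2 ≤ p) (hpn : p ≤ n + 1) :
    (Nat.log p (n / (p - 1)) : ℤ) = ⌊Real.logb (p : ℝ) ((n : ℝ) / ((p : ℝ) - 1))⌋ := by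
  have h1 : (1 : ℝ) < p := by exact_mod_cast hp
  have h3 : (p : ℝ) ≤ n + 1 := by exact_mod_cast hpn
  have h2 : (1 : ℝ) ≤ (n : ℝ) / ((p : ℝ) - 1) := by
    rw [le_div_iff₀ (by linarith)]; linarith
  rw [Real.floor_logb_natCast (by linarith), Int.log_of_one_le_right _ h2]
  have : (p : ℝ) - 1 = ((p - 1 : ℕ) : ℝ) := by
    rw [Nat.cast_sub (by omega), Nat.cast_one]
  rw [this, Nat.floor_div_eq_div]

/-- `R_{m,n}` for even `m`: it is `m` if `n = 1`, and `∏ p, p ^ e_p` over all primes `p` if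
`n > 1`. The primes that do not lie below `m + n + 2` have `e_p = 0`. -/
def boundEven (m n : ℕ) : ℕ :=
  if n = 1 then m
  else ∏ p ∈ (Finset.range (m + n + 2)).filter Nat.Prime, p ^ expo m n p

/-- The integer `R_{m,n}`; for odd `m` it is `R_{2m,n}`. -/
def bound (m n : ℕ) : ℕ :=
  if 2 ∣ m then boundEven m n else boundEven (2 * m) n

end VirtualPeriod

/-! ### Zeros of p-adic analytic interpolations. -/

section

open Polynomial

/-! Let F be the characteristic polynomial and u the class of X in K[X]/(F), so that a_k is the
value of a fixed linear functional at u^k. The heart is a Skolem–Mahler–Lech theorem with controlled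
modulus R = R_{m,n}: each residue class modulo R contains finitely many zeros or consists of zeros
(`AnnihilatesSeq.finite_or_forall_modEq`).

Infinitely many zeros in a class force a progression of zeros in it, of some modulus R * M: embed K
in ℚ_p with p ≡ 1 mod m, interpolate the sequence along a progression by an analytic function on
ℤ_p, and note that its zeros accumulate (`exists_arithmetic_progression_of_infinite_zeros`). The
modulus descends to R (`AnnihilatesSeq.eq_zero_of_modEq`) because roots x, y of F whose ratio is a
root of unity satisfy x^R = y^R. This last fact is Galois theory: x and y have degree at most n over
K, so for every K-automorphism γ of the algebraic closure some γ^A and γ^B with A, B ≤ n fix them. A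
γ that raises p^E-th roots of unity to a well-chosen power u then imposes congruences on u^A and u^B
that bound E by e_p (`le_expo_of_isPrimitiveRoot`).

For the fields, ℚ(a_k) ⊆ ℚ(a_k') means that every σ fixing a_k' fixes a_k, so the same theorem is
applied to the zeros of σ(a_k) − a_k. The polynomial σ(F)F annihilates this sequence and has degree
2n, yet each of its roots has degree at most n, so R does not grow. -/

/-- Legendre's formula gives v_p(j!) ≤ j / (p - 1) ≤ j / 2; the last inequality is where p must be
odd. -/
theorem norm_prime_pow_div_factorial_le (p : ℕ) [hp : Fact p.Prime] (hp2 : 2 < p) (j : ℕ) :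
    ‖((p : ℚ_[p]) ^ j / (j.factorial : ℚ_[p]))‖ ≤ ((Real.sqrt p)⁻¹) ^ j := by
  have hp0 : (0 : ℝ) < p := by exact_mod_cast hp.out.pos
  have hp1 : (1 : ℝ) ≤ p := by exact_mod_cast hp.out.one_le
  have hs : (0 : ℝ) < Real.sqrt p := Real.sqrt_pos.mpr hp0
  have hs1 : (1 : ℝ) ≤ Real.sqrt p := Real.one_le_sqrt.mpr hp1
  have hj : (j.factorial : ℚ_[p]) ≠ 0 := by exact_mod_cast j.factorial_ne_zero
  have hv : 2 * padicValNat p j.factorial ≤ j := by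
    have := sub_one_mul_padicValNat_factorial (p := p) j
    have h2 : 2 * padicValNat p j.factorial ≤ (p - 1) * padicValNat p j.factorial :=
      Nat.mul_le_mul_right _ (by omega)
    omega
  rw [norm_div, norm_pow, Padic.norm_p, Padic.norm_eq_zpow_neg_valuation hj,
    Padic.valuation_natCast, zpow_neg, zpow_natCast, div_inv_eq_mul, inv_pow, inv_pow,
    inv_mul_le_iff₀ (by positivity), ← div_eq_mul_inv, le_div_iff₀ (by positivity)]
  have h1 : (p : ℝ) = Real.sqrt p ^ 2 := (Real.sq_sqrt hp0.le).symm
  calc (p : ℝ) ^ padicValNat p j.factorial * Real.sqrt p ^ j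
      = Real.sqrt p ^ (2 * padicValNat p j.factorial) * Real.sqrt p ^ j := by
        rw [pow_mul, ← h1]
    _ ≤ Real.sqrt p ^ j * Real.sqrt p ^ j := by
        gcongr
    _ = (p : ℝ) ^ j := by rw [← mul_pow, Real.mul_self_sqrt hp0.le]

/-- A series `∑ c j * D j` with integral polynomials `D j` of degree at most `j` and coefficients of
geometric decay is a power series that converges beyond the unit ball. -/
theorem exists_radius_gt_one_sum_eq_sum_eval (p : ℕ) [hp : Fact p.Prime] (ρ : ℝ) (hρ0 : 0 < ρ)
    (hρ1 : ρ < 1) (c : ℕ → ℚ_[p]) (hc : ∀ j, ‖c j‖ ≤ ρ ^ j) (D : ℕ → ℤ[X])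
    (hD : ∀ j, (D j).natDegree ≤ j) :
    ∃ f : FormalMultilinearSeries ℚ_[p] ℚ_[p] ℚ_[p], 1 < f.radius ∧
      ∀ t : ℚ_[p], ‖t‖ ≤ 1 → f.sum t = ∑' j, c j * aeval t (D j) := by
  -- The degree bound kills the entries with j < i, so the decay is governed by the larger index.
  -- This yields both the radius, at least 1/ρ, and the summability of the double family needed to
  -- exchange the sums.
  have hbd : ∀ j i, ‖c j * (((D j).coeff i : ℤ) : ℚ_[p])‖ ≤ ρ ^ max i j := by
    intro j i
    rcases le_or_gt i j with h | h
    · rw [max_eq_right h, norm_mul]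
      exact (mul_le_of_le_one_right (norm_nonneg _) (Padic.norm_int_le_one _)).trans (hc j)
    · rw [coeff_eq_zero_of_natDegree_lt ((hD j).trans_lt h)]
      simp only [Int.cast_zero, mul_zero, norm_zero]
      positivity
  let b : ℕ → ℚ_[p] := fun i => ∑' j, c j * (((D j).coeff i : ℤ) : ℚ_[p])
  have hb : ∀ i, ‖b i‖ ≤ ρ ^ i := fun i =>
    IsUltrametricDist.norm_tsum_le_of_forall_le_of_nonneg (by positivity) fun j =>
      (hbd j i).trans (pow_le_pow_of_le_one hρ0.le hρ1.le (le_max_left _ _))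
  refine ⟨FormalMultilinearSeries.ofScalars ℚ_[p] b, ?_, ?_⟩
  · let r : NNReal := ⟨ρ⁻¹, (inv_pos.mpr hρ0).le⟩
    have : (r : ENNReal) ≤
        (FormalMultilinearSeries.ofScalars ℚ_[p] b).radius := by
      refine FormalMultilinearSeries.le_radius_of_bound _ 1 fun n => ?_
      rw [FormalMultilinearSeries.ofScalars_norm]
      change ‖b n‖ * (ρ⁻¹) ^ n ≤ 1
      calc ‖b n‖ * (ρ⁻¹) ^ n ≤ ρ ^ n * (ρ⁻¹) ^ n := by gcongr; exact hb n
        _ = 1 := by rw [← mul_pow, mul_inv_cancel₀ hρ0.ne', one_pow]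
    refine lt_of_lt_of_le ?_ this
    rw [← ENNReal.coe_one, ENNReal.coe_lt_coe, ← NNReal.coe_lt_coe]
    exact (one_lt_inv₀ hρ0).mpr hρ1
  · intro t ht
    have hsum : Summable fun x : ℕ × ℕ => c x.1 * (((D x.1).coeff x.2 : ℤ) : ℚ_[p]) * t ^ x.2 := by
      apply NonarchimedeanAddGroup.summable_of_tendsto_cofinite_zero
      rw [tendsto_zero_iff_norm_tendsto_zero, Metric.tendsto_nhds]
      intro ε hε
      obtain ⟨N, hN⟩ := exists_pow_lt_of_lt_one hε hρ1
      refine ((Set.finite_Iio N).prod (Set.finite_Iio N)).subset fun x hx => ?_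
      by_contra hx'
      apply hx
      have hmax : N ≤ max x.2 x.1 := by
        simp only [Set.mem_prod, Set.mem_Iio, not_and_or, not_lt] at hx'
        rcases hx' with h | h
        · exact h.trans (le_max_right _ _)
        · exact h.trans (le_max_left _ _)
      simp only [Real.dist_eq, sub_zero, abs_norm, Set.mem_ofPred_eq]
      rw [norm_mul, norm_pow]
      calc _ ≤ ‖c x.1 * (((D x.1).coeff x.2 : ℤ) : ℚ_[p])‖ :=
            mul_le_of_le_one_right (norm_nonneg _) (pow_le_one₀ (norm_nonneg _) ht)
        _ ≤ ρ ^ max x.2 x.1 := hbd _ _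
        _ ≤ ρ ^ N := pow_le_pow_of_le_one hρ0.le hρ1.le hmax
        _ < ε := hN
    have hj : ∀ j, c j * aeval t (D j) =
        ∑' i, c j * (((D j).coeff i : ℤ) : ℚ_[p]) * t ^ i := by
      intro j
      have h0 : ∀ i ∉ Finset.range ((D j).natDegree + 1),
          c j * (((D j).coeff i : ℤ) : ℚ_[p]) * t ^ i = 0 := by
        intro i hi
        have hi' : (D j).natDegree < i := by
          rw [Finset.mem_range] at hi
          omega
        simp [coeff_eq_zero_of_natDegree_lt hi']
      rw [(hasSum_sum_of_ne_finset_zero h0).tsum_eq, aeval_eq_sum_range, Finset.mul_sum]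
      refine Finset.sum_congr rfl fun i _ => ?_
      rw [zsmul_eq_mul, mul_assoc]
    have hcomm := Summable.tsum_comm
      (f := fun j i => c j * (((D j).coeff i : ℤ) : ℚ_[p]) * t ^ i) hsum
    calc (FormalMultilinearSeries.ofScalars ℚ_[p] b).sum t = ∑' i, b i * t ^ i :=
          tsum_congr fun i => FormalMultilinearSeries.ofScalars_apply_eq b t i
      _ = ∑' i, ∑' j, c j * (((D j).coeff i : ℤ) : ℚ_[p]) * t ^ i :=
          tsum_congr fun i => tsum_mul_right.symm
      _ = ∑' j, ∑' i, c j * (((D j).coeff i : ℤ) : ℚ_[p]) * t ^ i := hcomm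
      _ = ∑' j, c j * aeval t (D j) := tsum_congr fun j => (hj j).symm

/-- If `t ↦ ∑ j, choose t j * p ^ j * w j` has infinitely many zeros among the natural numbers,
then it vanishes on an arithmetic progression. -/
theorem exists_arithmetic_progression_of_infinite_zeros (p : ℕ) [hp : Fact p.Prime] (hp2 : 2 < p)
    (w : ℕ → ℤ_[p])
    (hinf : {t : ℕ | ∑ j ∈ Finset.range (t + 1),
      (t.choose j : ℤ_[p]) * (p : ℤ_[p]) ^ j * w j = 0}.Infinite) :
    ∃ t₀ M : ℕ, 0 < M ∧ ∀ t, ∑ j ∈ Finset.range (t₀ + M * t + 1),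
      ((t₀ + M * t).choose j : ℤ_[p]) * (p : ℤ_[p]) ^ j * w j = 0 := by
  have hp1 : (1 : ℝ) < p := by exact_mod_cast hp.out.one_lt
  have hs : (1 : ℝ) < Real.sqrt p := by rw [Real.lt_sqrt] <;> linarith
  -- Since choose t j is the falling factorial of t over j!, the weights p ^ j / j! leave integral
  -- polynomials in t.
  obtain ⟨f, hf, hfs⟩ := exists_radius_gt_one_sum_eq_sum_eval p (Real.sqrt p)⁻¹ (by positivity)
    (inv_lt_one_of_one_lt₀ hs)
    (fun j => (p : ℚ_[p]) ^ j / (j.factorial : ℚ_[p]) * (w j : ℚ_[p]))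
    (fun j => by
      rw [norm_mul]
      exact (mul_le_of_le_one_right (norm_nonneg _) (w j).2).trans
        (norm_prime_pow_div_factorial_le p hp2 j))
    (descPochhammer ℤ) (fun j => (descPochhammer_natDegree ℤ j).le)
  have hfn : ∀ t : ℕ, f.sum (t : ℚ_[p]) = ((∑ j ∈ Finset.range (t + 1),
      (t.choose j : ℤ_[p]) * (p : ℤ_[p]) ^ j * w j : ℤ_[p]) : ℚ_[p]) := by
    intro t
    rw [hfs _ (by simpa using Padic.norm_int_le_one (p := p) t)]
    have hev : ∀ j, aeval (t : ℚ_[p]) (descPochhammer ℤ j) =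
        (j.factorial : ℚ_[p]) * (t.choose j : ℚ_[p]) := by
      intro j
      have h := descPochhammer_eval_eq_descFactorial ℤ t j
      have h2 := congrArg (Int.cast : ℤ → ℚ_[p]) h
      rw [Nat.descFactorial_eq_factorial_mul_choose] at h2
      push_cast at h2
      rw [← h2]
      have := aeval_algebraMap_apply ℚ_[p] (t : ℤ) (descPochhammer ℤ j)
      simpa using this
    have h0 : ∀ j ∉ Finset.range (t + 1), (p : ℚ_[p]) ^ j / (j.factorial : ℚ_[p]) *
        (w j : ℚ_[p]) * aeval (t : ℚ_[p]) (descPochhammer ℤ j) = 0 := by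
      intro j hj
      rw [Finset.mem_range] at hj
      simp [hev, Nat.choose_eq_zero_of_lt (show t < j by omega)]
    rw [(hasSum_sum_of_ne_finset_zero h0).tsum_eq]
    rw [PadicInt.coe_sum]
    refine Finset.sum_congr rfl fun j _ => ?_
    push_cast
    have hj : (j.factorial : ℚ_[p]) ≠ 0 := by exact_mod_cast j.factorial_ne_zero
    rw [hev]
    field_simp
  set Z : Set ℕ := {t : ℕ | ∑ j ∈ Finset.range (t + 1),
    (t.choose j : ℤ_[p]) * (p : ℤ_[p]) ^ j * w j = 0} with hZ
  have hZf : ∀ t : ℕ, t ∈ Z ↔ f.sum (t : ℚ_[p]) = 0 := by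
    intro t
    rw [hfn, hZ, Set.mem_ofPred_eq, PadicInt.coe_eq_zero]
  have hinj : Function.Injective (Nat.cast : ℕ → ℤ_[p]) := Nat.cast_injective
  obtain ⟨z, -, hz⟩ := (hinf.image hinj.injOn).exists_accPt_of_subset_isCompact
    (isCompact_univ) (Set.subset_univ _)
  rw [accPt_iff_frequently] at hz
  have han : AnalyticAt ℚ_[p] f.sum (z : ℚ_[p]) := by
    have h1 := f.hasFPowerSeriesOnBall (lt_trans zero_lt_one hf)
    refine h1.analyticAt_of_mem ?_
    rw [Metric.mem_eball, edist_zero_right]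
    refine lt_of_le_of_lt ?_ hf
    rw [← ofReal_norm]
    exact ENNReal.ofReal_le_one.mpr z.2
  have hcoe : Filter.Tendsto (fun x : ℤ_[p] => (x : ℚ_[p])) (nhds z) (nhds (z : ℚ_[p])) :=
    continuous_subtype_val.continuousAt
  have hzero : ∀ᶠ x : ℤ_[p] in nhds z, f.sum (x : ℚ_[p]) = 0 := by
    rcases han.eventually_eq_zero_or_eventually_ne_zero with h | h
    · exact hcoe.eventually h
    · exfalso
      rw [eventually_nhdsWithin_iff] at h
      obtain ⟨y, ⟨hyz, t, ht, rfl⟩, hy⟩ := (hz.and_eventually (hcoe.eventually h)).exists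
      refine hy (fun h' => hyz (PadicInt.ext h')) ?_
      simpa using (hZf t).mp ht
  -- The function vanishes near the accumulation point z, so it vanishes near some natural number t
  -- close to z; t + p ^ s * u stays in that neighbourhood for large s.
  obtain ⟨y, ⟨hyz, t, ht, rfl⟩, hy⟩ :=
    (hz.and_eventually (eventually_eventually_nhds.mpr hzero)).exists
  obtain ⟨ε, hε, hball⟩ := Metric.eventually_nhds_iff.mp hy
  obtain ⟨s, hs⟩ := exists_pow_lt_of_lt_one hε (inv_lt_one_of_one_lt₀ hp1)
  refine ⟨t, p ^ s, pow_pos hp.out.pos s, fun u => ?_⟩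
  refine (hZf _).mpr ?_
  have := hball (y := ((t + p ^ s * u : ℕ) : ℤ_[p])) (by
    rw [dist_eq_norm]
    push_cast
    rw [add_sub_cancel_left, norm_mul, norm_pow, PadicInt.norm_p]
    exact lt_of_le_of_lt (mul_le_of_le_one_right (by positivity) (PadicInt.norm_le_one _)) hs)
  simpa using this

/-! ### Annihilating polynomials and sequences in ℤ_p. -/

/-- The linear functional on polynomials that sends `X ^ k` to `a k`. -/
noncomputable def seqFunctional {A : Type*} [CommRing A] (a : ℕ → A) : A[X] →ₗ[A] A :=
  Polynomial.lsum fun k => a k • LinearMap.id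

theorem seqFunctional_monomial {A : Type*} [CommRing A] (a : ℕ → A) (k : ℕ) (c : A) :
    seqFunctional a (monomial k c) = a k * c := by
  simp [seqFunctional, Polynomial.sum_monomial_index]

theorem seqFunctional_X_pow {A : Type*} [CommRing A] (a : ℕ → A) (k : ℕ) :
    seqFunctional a (X ^ k) = a k := by
  rw [X_pow_eq_monomial, seqFunctional_monomial, mul_one]

theorem seqFunctional_map {A B : Type*} [CommRing A] [CommRing B] (f : A →+* B) (a : ℕ → A)
    (P : A[X]) : seqFunctional (fun k => f (a k)) (P.map f) = f (seqFunctional a P) := by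
  induction P using Polynomial.induction_on' with
  | add P Q hP hQ => simp only [Polynomial.map_add, map_add, hP, hQ]
  | monomial k c => simp only [map_monomial, seqFunctional_monomial, map_mul]

theorem seqFunctional_sub {A : Type*} [CommRing A] (a b : ℕ → A) (P : A[X]) :
    seqFunctional (fun k => a k - b k) P = seqFunctional a P - seqFunctional b P := by
  induction P using Polynomial.induction_on' with
  | add P Q hP hQ => simp only [map_add, hP, hQ]; ring
  | monomial k c => simp only [seqFunctional_monomial]; ring

/-- The polynomial `F`, read as a polynomial in the shift operator, annihilates the sequence. -/
def AnnihilatesSeq {A : Type*} [CommRing A] (F : A[X]) (a : ℕ → A) : Prop :=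
  ∀ P : A[X], seqFunctional a (F * P) = 0

theorem annihilatesSeq_of_forall_X_pow {A : Type*} [CommRing A] {F : A[X]} {a : ℕ → A}
    (h : ∀ k, seqFunctional a (F * X ^ k) = 0) : AnnihilatesSeq F a := by
  intro P
  induction P using Polynomial.induction_on' with
  | add P Q hP hQ => rw [mul_add, map_add, hP, hQ, add_zero]
  | monomial k c =>
    rw [← C_mul_X_pow_eq_monomial, mul_left_comm, ← smul_eq_C_mul, map_smul, h, smul_zero]

theorem AnnihilatesSeq.map {A B : Type*} [CommRing A] [CommRing B] {F : A[X]} {a : ℕ → A}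
    (h : AnnihilatesSeq F a) (f : A →+* B) : AnnihilatesSeq (F.map f) fun k => f (a k) := by
  refine annihilatesSeq_of_forall_X_pow fun k => ?_
  rw [← map_X f, ← Polynomial.map_pow, ← Polynomial.map_mul, seqFunctional_map, h, map_zero]

theorem AnnihilatesSeq.of_map {A B : Type*} [CommRing A] [CommRing B] {F : A[X]} {a : ℕ → A}
    {f : A →+* B} (hf : Function.Injective f)
    (h : AnnihilatesSeq (F.map f) fun k => f (a k)) : AnnihilatesSeq F a := by
  intro P
  apply hf
  rw [← seqFunctional_map, Polynomial.map_mul, h, map_zero]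

theorem AnnihilatesSeq.sub {A : Type*} [CommRing A] {F G : A[X]} {a b : ℕ → A}
    (ha : AnnihilatesSeq F a) (hb : AnnihilatesSeq G b) :
    AnnihilatesSeq (F * G) fun k => a k - b k := by
  intro P
  rw [seqFunctional_sub, mul_assoc, ha, zero_sub, mul_left_comm, hb, neg_zero]

theorem isUnit_root_of_isUnit_coeff_zero {A : Type*} [CommRing A] (F : A[X])
    (h0 : IsUnit (F.coeff 0)) : IsUnit (AdjoinRoot.root F) := by
  have h1 : AdjoinRoot.mk F (X * F.divX + C (F.coeff 0)) = 0 := by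
    rw [X_mul_divX_add, AdjoinRoot.mk_self]
  rw [map_add, map_mul, AdjoinRoot.mk_X, AdjoinRoot.mk_C] at h1
  have h2 : IsUnit (AdjoinRoot.root F * AdjoinRoot.mk F F.divX) := by
    rw [eq_neg_of_add_eq_zero_left h1]
    exact (h0.map _).neg
  exact isUnit_of_mul_isUnit_left h2

/-- Modulo p, the class of X is a unit of the finite ring 𝔽_p[X]/(F), hence has finite order M. -/
theorem exists_X_pow_eq_one_add_prime_mul (p : ℕ) [hp : Fact p.Prime] (F : ℤ_[p][X])
    (hF : F.Monic) (h0 : IsUnit (F.coeff 0)) :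
    ∃ (M : ℕ) (S G : ℤ_[p][X]), 0 < M ∧ X ^ M = 1 + C (p : ℤ_[p]) * S + F * G := by
  let Fb := F.map (PadicInt.toZMod (p := p))
  have hFb : Fb.Monic := hF.map _
  have : Module.Finite (ZMod p) (AdjoinRoot Fb) := hFb.finite_adjoinRoot
  have hfin : Finite (AdjoinRoot Fb) := Module.finite_of_finite (ZMod p)
  have hu : IsUnit (AdjoinRoot.root Fb) :=
    isUnit_root_of_isUnit_coeff_zero Fb (by rw [coeff_map]; exact h0.map _)
  obtain ⟨u, hu⟩ := hu
  obtain ⟨M, hM, hu1⟩ := isOfFinOrder_iff_pow_eq_one.mp (isOfFinOrder_of_finite u)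
  have hdvd : Fb ∣ X ^ M - 1 := by
    rw [← AdjoinRoot.mk_eq_zero, map_sub, map_pow, AdjoinRoot.mk_X, map_one, ← hu,
      ← Units.val_pow_eq_pow_val, hu1, Units.val_one, sub_self]
  obtain ⟨Gb, hGb⟩ := hdvd
  obtain ⟨G, rfl⟩ := Polynomial.map_surjective _ (ZMod.ringHom_surjective PadicInt.toZMod) Gb
  have hS : C (p : ℤ_[p]) ∣ X ^ M - 1 - F * G := by
    rw [C_dvd_iff_dvd_coeff]
    intro i
    rw [← Ideal.mem_span_singleton, ← PadicInt.maximalIdeal_eq_span_p, ← PadicInt.ker_toZMod,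
      RingHom.mem_ker, ← coeff_map]
    have : (X ^ M - 1 - F * G).map (PadicInt.toZMod (p := p)) = 0 := by
      rw [Polynomial.map_sub, Polynomial.map_mul, Polynomial.map_sub, Polynomial.map_pow, map_X,
        Polynomial.map_one, hGb, sub_self]
    rw [this, coeff_zero]
  obtain ⟨S, hS⟩ := hS
  exact ⟨M, S, G, hM, by rw [← hS]; ring⟩

theorem exists_infinite_residue {Z : Set ℕ} (hZ : Z.Infinite) {M : ℕ} (hM : 0 < M) :
    ∃ r, {t : ℕ | r + M * t ∈ Z}.Infinite := by
  by_contra! h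
  apply hZ
  have : (⋃ r ∈ Finset.range M, (fun t => r + M * t) '' {t : ℕ | r + M * t ∈ Z}).Finite :=
    (Finset.range M).finite_toSet.biUnion fun r _ =>
      (h r).image _
  refine this.subset fun k hk => ?_
  simp only [Set.mem_iUnion]
  refine ⟨k % M, Finset.mem_range.mpr (Nat.mod_lt _ hM), k / M, ?_, Nat.mod_add_div k M⟩
  change k % M + M * (k / M) ∈ Z
  rwa [Nat.mod_add_div]

/-- Modulo F, X ^ (R * M) has the form 1 + p S'. The binomial expansion of its t-th power writes a
(r + R * M * t) as the sum of choose t j * p ^ j * w j, with w j the functional at X ^ r * S' ^ j.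
Steps divisible by R keep the progression inside the class. -/
theorem AnnihilatesSeq.exists_arithmetic_progression_padicInt (p : ℕ) [hp : Fact p.Prime]
    (hp2 : 2 < p) {F : ℤ_[p][X]} (hF : F.Monic) (h0 : IsUnit (F.coeff 0)) {a : ℕ → ℤ_[p]}
    (ha : AnnihilatesSeq F a) {R i : ℕ} (hR : 0 < R)
    (hZ : {k : ℕ | a k = 0 ∧ k ≡ i [MOD R]}.Infinite) :
    ∃ k₀ M : ℕ, k₀ ≡ i [MOD R] ∧ 0 < M ∧ ∀ t, a (k₀ + R * M * t) = 0 := by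
  obtain ⟨M, S, G, hM, hSG⟩ := exists_X_pow_eq_one_add_prime_mul p F hF h0
  obtain ⟨r, hr⟩ := exists_infinite_residue hZ (Nat.mul_pos hR hM)
  have hri : r ≡ i [MOD R] := by
    obtain ⟨t, ht⟩ := hr.nonempty
    have h1 : r + R * M * t ≡ i [MOD R] := ht.2
    have h2 : r + R * M * t ≡ r [MOD R] := by
      rw [mul_assoc]
      exact Nat.modEq_iff_dvd.mpr ⟨-(M * t), by push_cast; ring⟩
    exact h2.symm.trans h1
  obtain ⟨S', G', hSG'⟩ : ∃ S' G' : ℤ_[p][X],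
      X ^ (R * M) = 1 + C (p : ℤ_[p]) * S' + F * G' := by
    have h1 : (X ^ M : ℤ_[p][X]) - 1 ∣ (X ^ M) ^ R - 1 := sub_one_dvd_pow_sub_one _ _
    obtain ⟨Q, hQ⟩ := h1
    refine ⟨S * Q, G * Q, ?_⟩
    rw [mul_comm R M, pow_mul]
    linear_combination hQ + Q * hSG
  have key : ∀ t, a (r + R * M * t) = ∑ j ∈ Finset.range (t + 1),
      (t.choose j : ℤ_[p]) * (p : ℤ_[p]) ^ j * seqFunctional a (X ^ r * S' ^ j) := by
    intro t
    have h1 : F ∣ X ^ (r + R * M * t) - X ^ r * (1 + C (p : ℤ_[p]) * S') ^ t := by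
      rw [pow_add, pow_mul, ← mul_sub]
      refine Dvd.dvd.mul_left (Dvd.dvd.trans ?_ (sub_dvd_pow_sub_pow _ _ t)) _
      exact ⟨G', by rw [hSG']; ring⟩
    obtain ⟨Q, hQ⟩ := h1
    have h2 := ha Q
    rw [← hQ, map_sub, seqFunctional_X_pow, sub_eq_zero] at h2
    rw [h2, add_comm (1 : ℤ_[p][X]), add_pow, Finset.mul_sum, map_sum]
    refine Finset.sum_congr rfl fun j _ => ?_
    have h3 : X ^ r * ((C (p : ℤ_[p]) * S') ^ j * 1 ^ (t - j) * (t.choose j : ℤ_[p][X])) =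
        C ((t.choose j : ℤ_[p]) * (p : ℤ_[p]) ^ j) * (X ^ r * S' ^ j) := by
      simp only [map_mul, map_pow, map_natCast, one_pow]
      ring
    rw [h3, ← smul_eq_C_mul, map_smul, smul_eq_mul]
  have hinf : {t : ℕ | ∑ j ∈ Finset.range (t + 1), (t.choose j : ℤ_[p]) * (p : ℤ_[p]) ^ j *
      seqFunctional a (X ^ r * S' ^ j) = 0}.Infinite := by
    refine hr.mono fun t ht => ?_
    change _ = _
    rw [← key]
    exact ht.1
  obtain ⟨t₀, N, hN, h⟩ := exists_arithmetic_progression_of_infinite_zeros p hp2 _ hinf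
  refine ⟨r + R * M * t₀, M * N, ?_, Nat.mul_pos hM hN, fun t => ?_⟩
  · refine Nat.ModEq.trans ?_ hri
    rw [mul_assoc]
    exact Nat.modEq_iff_dvd.mpr ⟨-(M * t₀), by push_cast; ring⟩
  · have := h t
    rw [← key] at this
    rw [← this]
    congr 1
    ring

/-! ### Descent of the modulus from R * M to R. -/

theorem exists_dvd_pow_of_forall_isRoot {L : Type*} [Field L] [IsAlgClosed L] {F G : L[X]}
    (hF : F ≠ 0) (h : ∀ x, F.IsRoot x → G.IsRoot x) : ∃ n, F ∣ G ^ n := by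
  have key : ∀ s : Multiset L, (∀ x ∈ s, G.IsRoot x) →
      (s.map fun x => X - C x).prod ∣ G ^ s.card := by
    intro s
    induction s using Multiset.induction_on with
    | empty => simp
    | cons x s ih =>
      intro hs
      rw [Multiset.map_cons, Multiset.prod_cons, Multiset.card_cons, pow_succ']
      exact mul_dvd_mul (dvd_iff_isRoot.mpr (hs x (Multiset.mem_cons_self x s)))
        (ih fun y hy => hs y (Multiset.mem_cons_of_mem hy))
  refine ⟨F.roots.card, ?_⟩
  have h1 := (IsAlgClosed.splits F).eq_prod_roots
  have h2 := key F.roots fun x hx => h x ((mem_roots hF).mp hx)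
  have h3 : IsUnit (C F.leadingCoeff) := isUnit_C.mpr (leadingCoeff_ne_zero.mpr hF).isUnit
  exact h1.dvd.trans (h3.mul_left_dvd.mpr h2)

/-- Let `F` annihilate `a`, with `F (0) ≠ 0`. If roots of `F` with the same `R * M`-th power have
the same `R`-th power and `a` vanishes on a progression of modulus `R * M`, then `a` vanishes on
the whole residue class modulo `R`. -/
theorem AnnihilatesSeq.eq_zero_of_modEq {L : Type*} [Field L] [IsAlgClosed L] [CharZero L]
    {F : L[X]} (h0 : F.coeff 0 ≠ 0) {a : ℕ → L} (ha : AnnihilatesSeq F a) {R M k₀ : ℕ}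
    (hM : 0 < M)
    (hroots : ∀ x y : L, F.IsRoot x → F.IsRoot y → x ^ (R * M) = y ^ (R * M) → x ^ R = y ^ R)
    (hz : ∀ t, a (k₀ + R * M * t) = 0) {k : ℕ} (hk : k ≡ k₀ [MOD R]) : a k = 0 := by
  classical
  have hF0 : F ≠ 0 := by rintro rfl; simp at h0
  let u := AdjoinRoot.root F
  have hu : IsUnit u := isUnit_root_of_isUnit_coeff_zero F h0.isUnit
  -- The aim is u ^ R ∈ B. Then u ^ k is u ^ k₀ times a polynomial in u ^ (R * M), which makes a k a
  -- combination of the vanishing terms a (k₀ + R * M * t).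
  let B : Subalgebra L (AdjoinRoot F) := Algebra.adjoin L {u ^ (R * M)}
  have : Module.Finite L (AdjoinRoot F) := (AdjoinRoot.powerBasis hF0).finite
  have hint : Algebra.IsIntegral B (AdjoinRoot F) := Algebra.IsIntegral.tower_top (R := L)
  have hunit : ∀ b : B, IsUnit (b : AdjoinRoot F) → IsUnit b := fun b hb =>
    (isUnit_map_iff (algebraMap B (AdjoinRoot F)) b).mp hb
  -- interpolation of `x ^ (R * M) ↦ x ^ R` on the roots of `F`
  obtain ⟨q, hq⟩ : ∃ q : L[X], ∀ x, F.IsRoot x → q.eval (x ^ (R * M)) = x ^ R := by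
    let s : Finset L := F.roots.toFinset.image fun x => x ^ (R * M)
    have hs : ∀ y ∈ s, ∃ x, F.IsRoot x ∧ x ^ (R * M) = y := by
      intro y hy
      obtain ⟨x, hx, rfl⟩ := Finset.mem_image.mp hy
      exact ⟨x, (mem_roots hF0).mp (Multiset.mem_toFinset.mp hx), rfl⟩
    choose! g hg1 hg2 using hs
    refine ⟨Lagrange.interpolate s id fun y => g y ^ R, fun x hx => ?_⟩
    have hxs : x ^ (R * M) ∈ s :=
      Finset.mem_image.mpr ⟨x, Multiset.mem_toFinset.mpr ((mem_roots hF0).mpr hx), rfl⟩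
    have := Lagrange.eval_interpolate_at_node (fun y => g y ^ R) (v := id)
      Function.injective_id.injOn hxs
    rw [id] at this
    rw [this]
    exact hroots _ _ (hg1 _ hxs) hx (hg2 _ hxs)
  let x₀ : B := aeval ⟨u ^ (R * M), Algebra.subset_adjoin rfl⟩ q
  have hx₀ : (x₀ : AdjoinRoot F) = aeval (u ^ (R * M)) q := by
    simp only [x₀]
    rw [← Subalgebra.coe_val, ← aeval_algHom_apply]
    rfl
  -- The two sides agree at every root of F; multiplicities of the roots account for the nilpotent
  -- error.
  have hnil : IsNilpotent ((x₀ : AdjoinRoot F) - u ^ R) := by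
    have hroot : ∀ x, F.IsRoot x → (q.comp (X ^ (R * M)) - X ^ R).IsRoot x := by
      intro x hx
      simp only [IsRoot.def, eval_sub, eval_comp, eval_pow, eval_X, hq x hx, sub_self]
    obtain ⟨n, hn⟩ := exists_dvd_pow_of_forall_isRoot hF0 hroot
    refine ⟨n, ?_⟩
    rw [← AdjoinRoot.mk_eq_zero, map_pow, map_sub, map_pow, AdjoinRoot.mk_X,
      ← AdjoinRoot.aeval_eq, aeval_comp, map_pow, aeval_X] at hn
    rw [hx₀]
    exact hn
  have hx₀u : IsUnit (x₀ : AdjoinRoot F) := by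
    have := hnil.isUnit_add_left_of_commute (hu.pow R) (Commute.all _ _)
    rwa [add_sub_cancel] at this
  let P : B[X] := X ^ M - C ⟨u ^ (R * M), Algebra.subset_adjoin rfl⟩
  have hP1 : aeval (u ^ R) P = 0 := by
    simp only [P, map_sub, map_pow, aeval_X, aeval_C, ← pow_mul]
    exact sub_self _
  have hP2 : (aeval x₀ (derivative P) : B) = M * x₀ ^ (M - 1) := by
    simp [P, derivative_X_pow]
  have hPnil : IsNilpotent (aeval x₀ P) := by
    obtain ⟨n, hn⟩ : IsNilpotent ((x₀ : AdjoinRoot F) ^ M - (u ^ R) ^ M) := by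
      obtain ⟨c, hc⟩ := sub_dvd_pow_sub_pow (x₀ : AdjoinRoot F) (u ^ R) M
      rw [hc]
      exact (Commute.all _ _).isNilpotent_mul_right hnil
    refine ⟨n, Subtype.ext ?_⟩
    simp only [P, map_sub, map_pow, aeval_X, aeval_C]
    rw [← pow_mul] at hn
    exact hn
  have hMunit : IsUnit (M : B) := by
    have h1 : IsUnit (M : L) := (Nat.cast_ne_zero.mpr hM.ne').isUnit
    simpa using h1.map (algebraMap L B)
  have hPunit : IsUnit (aeval x₀ (derivative P)) := by
    rw [hP2]
    exact hMunit.mul ((hunit x₀ hx₀u).pow _)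
  -- Newton–Hensel: T ^ M - u ^ (R * M) has a root in B that differs from x₀ by a nilpotent. Such a
  -- root is unique in the whole ring, and u ^ R is one.
  have hB : u ^ R ∈ B := by
    obtain ⟨r, ⟨hr1, hr2⟩, -⟩ := existsUnique_nilpotent_sub_and_aeval_eq_zero hPnil hPunit
    have hcoe : ∀ (Q : B[X]) (b : B), aeval (b : AdjoinRoot F) Q = (aeval b Q : B) := fun Q b =>
      aeval_algebraMap_apply (AdjoinRoot F) b Q
    have h1 : IsNilpotent (aeval (x₀ : AdjoinRoot F) P) := by
      rw [hcoe]
      exact hPnil.map (algebraMap B (AdjoinRoot F))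
    have h2 : IsUnit (aeval (x₀ : AdjoinRoot F) (derivative P)) := by
      rw [hcoe]
      exact hPunit.map (algebraMap B (AdjoinRoot F))
    have h3 : u ^ R = (r : AdjoinRoot F) :=
      (existsUnique_nilpotent_sub_and_aeval_eq_zero h1 h2).unique ⟨hnil, hP1⟩
        ⟨hr1.map (algebraMap B (AdjoinRoot F)), by rw [hcoe, hr2]; rfl⟩
    rw [h3]
    exact r.2
  obtain ⟨b, hb⟩ : ∃ b : B, u ^ k = u ^ k₀ * b := by
    rcases le_total k₀ k with h | h
    · obtain ⟨c, hc⟩ := (Nat.modEq_iff_dvd' h).mp hk.symm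
      refine ⟨⟨u ^ R, hB⟩ ^ c, ?_⟩
      rw [SubmonoidClass.coe_pow, ← pow_mul, ← pow_add, ← hc]
      congr 1
      omega
    · obtain ⟨c, hc⟩ := (Nat.modEq_iff_dvd' h).mp hk
      obtain ⟨v, hv⟩ := hunit ⟨u ^ R, hB⟩ (hu.pow R)
      refine ⟨(v⁻¹ : Bˣ) ^ c, ?_⟩
      have h1 : u ^ k₀ = u ^ k * ((v : B) ^ c : B) := by
        rw [hv, SubmonoidClass.coe_pow, ← pow_mul, ← pow_add, ← hc]
        congr 1
        omega
      have h2 : ((v : B) ^ c * ((v⁻¹ : Bˣ) : B) ^ c) = 1 := by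
        rw [← mul_pow, Units.mul_inv, one_pow]
      rw [h1, mul_assoc, ← MulMemClass.coe_mul, h2, OneMemClass.coe_one, mul_one]
  have hbB : (b : AdjoinRoot F) ∈ Algebra.adjoin L {u ^ (R * M)} := b.2
  rw [Algebra.adjoin_singleton_eq_range_aeval] at hbB
  obtain ⟨Q, hQ⟩ := hbB
  have hdvd : F ∣ X ^ k - X ^ k₀ * Q.comp (X ^ (R * M)) := by
    rw [← AdjoinRoot.mk_eq_zero, map_sub, map_mul, map_pow, map_pow, AdjoinRoot.mk_X,
      ← AdjoinRoot.aeval_eq, aeval_comp, map_pow, aeval_X, sub_eq_zero]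
    exact hb.trans (congrArg _ hQ.symm)
  obtain ⟨G, hG⟩ := hdvd
  have h1 := ha G
  rw [← hG, map_sub, seqFunctional_X_pow, sub_eq_zero] at h1
  rw [h1]
  clear * - hz
  induction Q using Polynomial.induction_on' with
  | add Q₁ Q₂ h₁ h₂ => rw [add_comp, mul_add, map_add, h₁, h₂, add_zero]
  | monomial t c =>
    rw [monomial_comp, ← pow_mul, mul_left_comm, ← pow_add, C_mul_X_pow_eq_monomial,
      seqFunctional_monomial, hz, zero_mul]

/-! ### Embeddings of the cyclotomic field in ℚ_p and the refined Skolem–Mahler–Lech theorem. -/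

/-- The cyclic group 𝔽_p^× has an element of order m because m ∣ p - 1, and Hensel's lemma lifts it,
X ^ m - 1 being separable modulo p. -/
theorem exists_isPrimitiveRoot_padic (p m : ℕ) [hp : Fact p.Prime] (hm : m ≠ 0)
    (hpm : p ≡ 1 [MOD m]) : ∃ z : ℚ_[p], IsPrimitiveRoot z m := by
  have hdvd : m ∣ p - 1 := (Nat.modEq_iff_dvd' hp.out.one_le).mp hpm.symm
  have hcop : ¬ p ∣ m := fun h => by
    have h1 := Nat.le_of_dvd (Nat.sub_pos_of_lt hp.out.one_lt) (h.trans hdvd)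
    have := hp.out.pos
    omega
  obtain ⟨g, hg⟩ : ∃ g : ZMod p, IsPrimitiveRoot g m := by
    obtain ⟨u, hu⟩ := IsCyclic.exists_ofOrder_eq_natCard (α := (ZMod p)ˣ)
    rw [Nat.card_eq_fintype_card, ZMod.card_units] at hu
    obtain ⟨c, hc⟩ := hdvd
    have h1 : IsPrimitiveRoot u (c * m) := by
      rw [mul_comm, ← hc, ← hu]
      exact IsPrimitiveRoot.orderOf u
    have h2 := h1.pow (Nat.pos_of_ne_zero (by
      rw [mul_comm, ← hc]; exact (Nat.sub_pos_of_lt hp.out.one_lt).ne')) rfl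
    exact ⟨_, IsPrimitiveRoot.coe_units_iff.mpr h2⟩
  obtain ⟨y, hy⟩ := ZMod.ringHom_surjective (PadicInt.toZMod (p := p)) g
  have hlt : ∀ x : ℤ_[p], ‖x‖ < 1 ↔ PadicInt.toZMod x = 0 := by
    intro x
    rw [← RingHom.mem_ker, PadicInt.ker_toZMod, IsLocalRing.mem_maximalIdeal, mem_nonunits_iff,
      PadicInt.isUnit_iff]
    exact ⟨fun h => h.ne, fun h => lt_of_le_of_ne (PadicInt.norm_le_one x) h⟩
  have hder : ‖aeval y (derivative (X ^ m - 1 : ℤ_[p][X]))‖ = 1 := by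
    refine le_antisymm (PadicInt.norm_le_one _) (not_lt.mp fun h => ?_)
    rw [hlt] at h
    simp only [derivative_sub, derivative_X_pow, derivative_one, sub_zero, map_mul, map_natCast,
      aeval_X, map_pow, hy, mul_eq_zero] at h
    rcases h with h | h
    · simp [ZMod.natCast_eq_zero_iff, hcop] at h
    · exact (hg.isUnit hm).ne_zero (eq_zero_of_pow_eq_zero h)
  obtain ⟨z, hz, hzy, -⟩ := hensels_lemma (F := (X ^ m - 1 : ℤ_[p][X])) (a := y) (by
    rw [hder, one_pow, hlt]
    simp [hy, hg.pow_eq_one])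
  rw [hder, hlt, map_sub, hy, sub_eq_zero] at hzy
  have hzm : z ^ m = 1 := by simpa [sub_eq_zero] using hz
  have hz' : IsPrimitiveRoot z m :=
    IsPrimitiveRoot.mk_of_lt z (Nat.pos_of_ne_zero hm) hzm fun l hl0 hlm h => by
      have : g ^ l = 1 := by rw [← hzy, ← map_pow, h, map_one]
      exact hg.pow_ne_one_of_pos_of_lt hl0.ne' hlm this
  exact ⟨_, hz'.map_of_injective (f := PadicInt.Coe.ringHom) Subtype.coe_injective⟩

/-- Take p ≡ 1 mod m larger than the denominators of all elements of S. Then ℚ_p contains a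
primitive m-th root of unity, and these denominators become units of ℤ_p. -/
theorem exists_ringHom_padic_of_isCyclotomicExtension (m : ℕ) [NeZero m] (K : Type*) [Field K]
    [Algebra ℚ K] [IsCyclotomicExtension {m} ℚ K] (S : Set K) (hS : S.Finite) :
    ∃ (p : ℕ) (_ : Fact p.Prime) (f : K →+* ℚ_[p]), 2 < p ∧
      ∀ x ∈ S, f x ∈ PadicInt.subring p := by
  have : CharZero K := algebraRat.charZero K
  have hden : ∀ x : K, ∃ d : ℤ, d ≠ 0 ∧ IsIntegral ℤ (d • x) := by
    intro x
    have : Algebra.IsIntegral ℚ K := (IsCyclotomicExtension.integral {m} ℚ K)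
    have h1 : IsAlgebraic ℤ x :=
      (IsFractionRing.isAlgebraic_iff ℤ ℚ K).mpr (Algebra.IsIntegral.isIntegral x).isAlgebraic
    exact h1.exists_integral_multiple
  choose d hd0 hd using hden
  obtain ⟨B, hB⟩ := (hS.image fun x => (d x).natAbs).bddAbove
  obtain ⟨p, hp, hpB, hpm⟩ := Nat.exists_prime_gt_modEq_one (k := m) (max 2 B) (NeZero.ne m)
  have hpf : Fact p.Prime := ⟨hp⟩
  obtain ⟨z, hz⟩ := exists_isPrimitiveRoot_padic p m (NeZero.ne m) hpm
  have hζ := IsCyclotomicExtension.zeta_spec m ℚ K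
  have hz0 : aeval z (minpoly ℚ (hζ.powerBasis ℚ).gen) = 0 := by
    rw [IsPrimitiveRoot.powerBasis_gen, ← hζ.minpoly_eq_cyclotomic_of_irreducible
      (cyclotomic.irreducible_rat (NeZero.pos m))]
    have := hz.isRoot_cyclotomic (NeZero.pos m)
    rwa [← map_cyclotomic m (algebraMap ℚ ℚ_[p]), IsRoot.def, eval_map_algebraMap] at this
  refine ⟨p, hpf, ((hζ.powerBasis ℚ).lift z hz0 : K →+* ℚ_[p]),
    lt_of_le_of_lt (le_max_left _ _) hpB, fun x hx => ?_⟩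
  set f : K →+* ℚ_[p] := ((hζ.powerBasis ℚ).lift z hz0 : K →+* ℚ_[p])
  have h1 : IsIntegral ℤ (f (d x • x)) := (hd x).map f.toIntAlgHom
  have h2 : IsIntegral ℤ_[p] (f (d x • x)) := h1.tower_top
  obtain ⟨y, hy⟩ := IsIntegrallyClosed.isIntegral_iff.mp h2
  have hdx : ‖((d x : ℤ) : ℚ_[p])‖ = 1 := by
    refine le_antisymm (Padic.norm_int_le_one _) (not_lt.mp fun h => ?_)
    have h3 := Int.natAbs_dvd_natAbs.mpr ((PadicInt.norm_int_lt_one_iff_dvd (p := p) (d x)).mp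
      (by rwa [PadicInt.norm_def, PadicInt.coe_intCast]))
    have h4 := Nat.le_of_dvd (Int.natAbs_pos.mpr (hd0 x)) h3
    have h5 := hB (Set.mem_image_of_mem _ hx)
    have h6 := le_max_right 2 B
    simp only [Int.natAbs_natCast] at h4
    omega
  have h3 : ‖f x‖ = ‖(y : ℚ_[p])‖ := by
    have h4 : (y : ℚ_[p]) = f (d x • x) := hy
    rw [h4, zsmul_eq_mul, map_mul, map_intCast, norm_mul, hdx, one_mul]
  change ‖f x‖ ≤ 1
  rw [h3]
  exact y.2

theorem seqFunctional_mul_X_pow {A : Type*} [CommRing A] (a : ℕ → A) (F : A[X]) (k : ℕ) :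
    seqFunctional a (F * X ^ k) =
      ∑ i ∈ Finset.range (F.natDegree + 1), F.coeff i * a (i + k) := by
  conv_lhs => rw [F.as_sum_range_C_mul_X_pow, Finset.sum_mul, map_sum]
  refine Finset.sum_congr rfl fun i _ => ?_
  rw [mul_assoc, ← pow_add, C_mul_X_pow_eq_monomial, seqFunctional_monomial, mul_comm]

theorem AnnihilatesSeq.mem_subring {A : Type*} [CommRing A] {F : A[X]} (hF : F.Monic)
    {a : ℕ → A} (ha : AnnihilatesSeq F a) (O : Subring A) (hFO : ∀ i, F.coeff i ∈ O)
    (haO : ∀ k < F.natDegree, a k ∈ O) (k : ℕ) : a k ∈ O := by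
  induction k using Nat.strong_induction_on with
  | _ k ih =>
    rcases lt_or_ge k F.natDegree with h | h
    · exact haO k h
    · have h1 := ha (X ^ (k - F.natDegree))
      rw [seqFunctional_mul_X_pow, Finset.sum_range_succ, hF.coeff_natDegree, one_mul,
        Nat.add_sub_cancel' h] at h1
      rw [eq_neg_of_add_eq_zero_right h1]
      refine O.neg_mem (O.sum_mem fun i hi => O.mul_mem (hFO i) (ih _ ?_))
      have := Finset.mem_range.mp hi
      omega

theorem AnnihilatesSeq.exists_arithmetic_progression (m : ℕ) [NeZero m] {K : Type*} [Field K]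
    [Algebra ℚ K] [IsCyclotomicExtension {m} ℚ K] {F : K[X]} (hF : F.Monic) (h0 : F.coeff 0 ≠ 0)
    {a : ℕ → K} (ha : AnnihilatesSeq F a) {R i : ℕ} (hR : 0 < R)
    (hZ : {k : ℕ | a k = 0 ∧ k ≡ i [MOD R]}.Infinite) :
    ∃ k₀ M : ℕ, k₀ ≡ i [MOD R] ∧ 0 < M ∧ ∀ t, a (k₀ + R * M * t) = 0 := by
  -- The inverse of F(0) is made integral as well, so that the constant term becomes a unit of ℤ_p.
  obtain ⟨p, hp, f, hp2, hf⟩ := exists_ringHom_padic_of_isCyclotomicExtension m K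
    (F.coeff '' Set.Iic F.natDegree ∪ a '' Set.Iio F.natDegree ∪ {(F.coeff 0)⁻¹})
    ((((Set.finite_Iic _).image _).union ((Set.finite_Iio _).image _)).union
      (Set.finite_singleton _))
  have hFO : ∀ j, F.coeff j ∈ (PadicInt.subring p).comap f := by
    intro j
    rcases le_or_gt j F.natDegree with h | h
    · exact hf _ (Or.inl (Or.inl ⟨j, h, rfl⟩))
    · rw [coeff_eq_zero_of_natDegree_lt h]
      exact Subring.zero_mem _
  have haO : ∀ k, a k ∈ (PadicInt.subring p).comap f :=
    ha.mem_subring hF _ hFO fun k hk => hf _ (Or.inl (Or.inr ⟨k, hk, rfl⟩))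
  let c : ℤ_[p] →+* ℚ_[p] := PadicInt.Coe.ringHom
  have hc : Function.Injective c := Subtype.coe_injective
  let b : ℕ → ℤ_[p] := fun k => ⟨f (a k), haO k⟩
  have hlift : F.map f ∈ lifts c := by
    rw [lifts_iff_coeff_lifts]
    intro j
    rw [coeff_map]
    exact ⟨⟨_, hFO j⟩, rfl⟩
  obtain ⟨G, hG, -, hGm⟩ := lifts_and_natDegree_eq_and_monic hlift (hF.map f)
  have hb : AnnihilatesSeq G b := by
    refine AnnihilatesSeq.of_map hc ?_
    rw [hG]
    exact ha.map f
  have hG0 : c (G.coeff 0) = f (F.coeff 0) := by rw [← coeff_map, hG, coeff_map]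
  have hGu : IsUnit (G.coeff 0) := by
    let y : ℤ_[p] := ⟨f (F.coeff 0)⁻¹, hf _ (Or.inr (Set.mem_singleton _))⟩
    have hy : c y = f (F.coeff 0)⁻¹ := rfl
    refine IsUnit.of_mul_eq_one y (hc ?_)
    rw [map_mul, hG0, map_one, hy, ← map_mul, mul_inv_cancel₀ h0, map_one]
  have hba : ∀ k, b k = 0 ↔ a k = 0 := by
    intro k
    rw [← PadicInt.coe_eq_zero]
    exact map_eq_zero f
  obtain ⟨k₀, M, h1, h2, h3⟩ := hb.exists_arithmetic_progression_padicInt p hp2 hGm hGu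
    (i := i) hR (hZ.mono fun k hk => ⟨(hba k).mpr hk.1, hk.2⟩)
  exact ⟨k₀, M, h1, h2, fun t => (hba _).mp (h3 t)⟩

/-- A refined Skolem–Mahler–Lech theorem over a cyclotomic field: a residue class modulo `R`
contains finitely many zeros of the sequence or consists of zeros. -/
theorem AnnihilatesSeq.finite_or_forall_modEq (m : ℕ) [NeZero m] {K : Type*} [Field K]
    [Algebra ℚ K] [IsCyclotomicExtension {m} ℚ K] {F : K[X]} (hF : F.Monic) (h0 : F.coeff 0 ≠ 0)
    {a : ℕ → K} (ha : AnnihilatesSeq F a) {R : ℕ} (hR : 0 < R)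
    (hroots : ∀ (x y : AlgebraicClosure K) (j : ℕ), aeval x F = 0 → aeval y F = 0 → 0 < j →
      x ^ j = y ^ j → x ^ R = y ^ R) (i : ℕ) :
    {k : ℕ | a k = 0 ∧ k ≡ i [MOD R]}.Finite ∨ ∀ k, k ≡ i [MOD R] → a k = 0 := by
  have : CharZero K := algebraRat.charZero K
  have : CharZero (AlgebraicClosure K) := charZero_of_injective_algebraMap
    (algebraMap K (AlgebraicClosure K)).injective
  refine or_iff_not_imp_left.mpr fun h k hk => ?_
  obtain ⟨k₀, M, h1, h2, h3⟩ := ha.exists_arithmetic_progression m hF h0 hR h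
  have key := (ha.map (algebraMap K (AlgebraicClosure K))).eq_zero_of_modEq (R := R) (M := M)
    (k₀ := k₀) (k := k) (by rw [coeff_map]; simpa using h0) h2
    (fun x y hx hy hxy => hroots x y (R * M)
      (by rwa [IsRoot.def, eval_map_algebraMap] at hx)
      (by rwa [IsRoot.def, eval_map_algebraMap] at hy) (Nat.mul_pos hR h2) hxy)
    (fun t => by rw [h3, map_zero]) (hk.trans h1.symm)
  simpa using key

/-! ### Orders of roots of unity that are ratios of elements of small degree. -/

/-- Lifting the exponent: v_p((1 + m)^k - 1) = v_p(m) + v_p(k) for k ≠ 0, which for p = 2 uses 4 ∣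
m. -/
theorem dvd_of_pow_dvd_one_add_pow_sub_one {p m E k : ℕ} (hp : p.Prime) (hm : m ≠ 0)
    (hpm : p ∣ m) (h4 : p = 2 → 4 ∣ m)
    (h : ((p ^ E : ℕ) : ℤ) ∣ ((1 + m : ℕ) : ℤ) ^ k - 1) : p ^ (E - padicValNat p m) ∣ k := by
  have hpf : Fact p.Prime := ⟨hp⟩
  have hpm' : (p : ℤ) ∣ m := Int.natCast_dvd_natCast.mpr hpm
  have hx : ¬ (p : ℤ) ∣ ((1 + m : ℕ) : ℤ) := by
    intro h1
    push_cast at h1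
    have h2 : (p : ℤ) ∣ 1 := (Int.dvd_add_left hpm').mp h1
    have h3 : (p : ℤ) ∣ ((1 : ℕ) : ℤ) := by simpa using h2
    exact hp.one_lt.ne' (Nat.dvd_one.mp (Int.natCast_dvd_natCast.mp h3))
  have hsub : ((1 + m : ℕ) : ℤ) - 1 = m := by push_cast; ring
  have key : emultiplicity (p : ℤ) (((1 + m : ℕ) : ℤ) ^ k - 1 ^ k) =
      emultiplicity p m + emultiplicity p k := by
    rcases hp.eq_two_or_odd' with rfl | hodd
    · have h1 := Int.two_pow_sub_pow' (x := ((1 + m : ℕ) : ℤ)) (y := 1) k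
        (by rw [hsub]; exact_mod_cast Int.natCast_dvd_natCast.mpr (h4 rfl)) (by simpa using hx)
      rw [hsub] at h1
      rw [← Int.natCast_emultiplicity, ← Int.natCast_emultiplicity]
      exact_mod_cast h1
    · rw [Int.emultiplicity_pow_sub_pow hp hodd (by rwa [hsub]) hx, hsub,
        Int.natCast_emultiplicity]
  rw [one_pow, ← padicValNat_eq_emultiplicity hm] at key
  rw [Nat.cast_pow, pow_dvd_iff_le_emultiplicity, key] at h
  rw [pow_dvd_iff_le_emultiplicity]
  rcases eq_or_ne k 0 with rfl | hk
  · simp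
  · rw [← padicValNat_eq_emultiplicity hk] at h ⊢
    norm_cast at h ⊢
    omega

theorem pow_dvd_or_pow_dvd_of_dvd_lcm {p e a b : ℕ} (hp : p.Prime) (ha : a ≠ 0) (hb : b ≠ 0)
    (h : p ^ e ∣ a.lcm b) : p ^ e ∣ a ∨ p ^ e ∣ b := by
  rw [hp.pow_dvd_iff_le_factorization (Nat.lcm_ne_zero ha hb), Nat.factorization_lcm ha hb,
    Finsupp.sup_apply, le_sup_iff] at h
  rwa [hp.pow_dvd_iff_le_factorization ha, hp.pow_dvd_iff_le_factorization hb]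

/-- Pigeonhole: the n + 1 conjugates γ^i α, 0 ≤ i ≤ n, lie among at most n roots. -/
theorem exists_algEquiv_pow_eq_self {K L : Type*} [Field K] [Field L] [Algebra K L] {f : K[X]}
    (hf : f ≠ 0) {n : ℕ} (hn : f.natDegree ≤ n) {α : L} (hα : aeval α f = 0) (γ : L ≃ₐ[K] L) :
    ∃ A, 0 < A ∧ A ≤ n ∧ (γ ^ A) α = α := by
  classical
  have hcard : (f.aroots L).toFinset.card < (Finset.range (n + 1)).card := by
    rw [Finset.card_range, Nat.lt_succ_iff]
    exact (Multiset.toFinset_card_le _).trans ((card_roots' _).trans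
      ((natDegree_map_le).trans hn))
  obtain ⟨i, hi, j, hj, hij, h⟩ := Finset.exists_ne_map_eq_of_card_lt_of_maps_to hcard
    (f := fun i => (γ ^ i) α) (fun i _ => by
      rw [Finset.mem_coe, Multiset.mem_toFinset, mem_aroots]
      exact ⟨hf, (aeval_algHom_apply (γ ^ i).toAlgHom α f).trans (by rw [hα, map_zero])⟩)
  rw [Finset.mem_range] at hi hj
  have aux : ∀ i j, i < j → j < n + 1 → (γ ^ i) α = (γ ^ j) α →
      ∃ A, 0 < A ∧ A ≤ n ∧ (γ ^ A) α = α := by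
    intro i j hij hj h
    refine ⟨j - i, by omega, by omega, (γ ^ i).injective ?_⟩
    rw [← AlgEquiv.mul_apply, ← pow_add, Nat.add_sub_cancel' hij.le, h]
  rcases lt_or_gt_of_ne hij with h' | h'
  · exact aux i j h' hj h
  · exact aux j i h' hi h.symm

section RatioOfPeriodicElements

variable {K L : Type*} [Field K] [Field L] [Algebra K L] {γ : L ≃ₐ[K] L} {η α β : L} {u q A B : ℕ}

theorem algEquiv_pow_apply_of_apply_eq_pow (hγ : γ η = η ^ u) (k : ℕ) :
    (γ ^ k) η = η ^ (u ^ k) := by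
  induction k with
  | zero => simp
  | succ k ih => rw [pow_succ', AlgEquiv.mul_apply, ih, map_pow, hγ, ← pow_mul, ← pow_succ']

theorem algEquiv_pow_apply_of_dvd (hA : (γ ^ A) α = α) {k : ℕ} (hk : A ∣ k) : (γ ^ k) α = α := by
  obtain ⟨c, rfl⟩ := hk
  induction c with
  | zero => simp
  | succ c ih => rw [Nat.mul_succ, pow_add, AlgEquiv.mul_apply, hA, ih]

/-- The power of γ with exponent lcm(A, B) fixes α and β, hence η = α/β. -/
theorem dvd_pow_lcm_sub_one (hη : IsPrimitiveRoot η q) (hq : q ≠ 0) (hγ : γ η = η ^ u)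
    (hβ : β ≠ 0) (hαβ : α = η * β) (hA : (γ ^ A) α = α) (hB : (γ ^ B) β = β) :
    (q : ℤ) ∣ (u : ℤ) ^ (A.lcm B) - 1 := by
  have hη0 : η ≠ 0 := (hη.isUnit hq).ne_zero
  have h1 := algEquiv_pow_apply_of_dvd hA (Nat.dvd_lcm_left A B)
  rw [hαβ, map_mul, algEquiv_pow_apply_of_dvd hB (Nat.dvd_lcm_right A B)] at h1
  have h2 := mul_right_cancel₀ hβ h1
  rw [algEquiv_pow_apply_of_apply_eq_pow hγ] at h2
  rw [← hη.zpow_eq_one_iff_dvd, zpow_sub₀ hη0, zpow_one, div_eq_one_iff_eq hη0]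
  exact_mod_cast h2

/-- As γ^A commutes with γ^B, it fixes γ^B α as well as α, hence also their ratio η^(u^B - 1). -/
theorem dvd_pow_sub_one_mul_pow_sub_one (hη : IsPrimitiveRoot η q) (hq : q ≠ 0)
    (hγ : γ η = η ^ u) (hβ : β ≠ 0) (hαβ : α = η * β) (hA : (γ ^ A) α = α)
    (hB : (γ ^ B) β = β) : (q : ℤ) ∣ ((u : ℤ) ^ A - 1) * ((u : ℤ) ^ B - 1) := by
  have hη0 : η ≠ 0 := (hη.isUnit hq).ne_zero
  have hα0 : α ≠ 0 := hαβ ▸ mul_ne_zero hη0 hβ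
  have h1 : (γ ^ B) α = η ^ ((u : ℤ) ^ B - 1) * α := by
    rw [hαβ, map_mul, hB, algEquiv_pow_apply_of_apply_eq_pow hγ, zpow_sub₀ hη0, zpow_one,
      ← mul_assoc, div_mul_cancel₀ _ hη0]
    norm_cast
  have h2 : (γ ^ A) ((γ ^ B) α) = (γ ^ B) α := by
    rw [← AlgEquiv.mul_apply, ← pow_add, add_comm, pow_add, AlgEquiv.mul_apply, hA]
  rw [h1, map_mul, hA] at h2
  have h3 := mul_right_cancel₀ hα0 h2
  rw [map_zpow₀, algEquiv_pow_apply_of_apply_eq_pow hγ] at h3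
  rw [← hη.zpow_eq_one_iff_dvd, sub_mul, one_mul, zpow_sub₀ hη0, zpow_mul,
    div_eq_one_iff_eq (zpow_ne_zero _ hη0), ← h3]
  norm_cast

end RatioOfPeriodicElements

/-- Irreducibility of the cyclotomic polynomial of order lcm(m, q) over ℚ gives an automorphism
raising roots of unity of that order to the power u; it fixes K because u ≡ 1 mod m. -/
theorem exists_algEquiv_forall_root_of_unity (m : ℕ) [NeZero m] {K : Type*} [Field K]
    [Algebra ℚ K] [IsCyclotomicExtension {m} ℚ K] {q u : ℕ} (hq : q ≠ 0) (hum : u ≡ 1 [MOD m])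
    (huq : u.Coprime q) : ∃ γ : AlgebraicClosure K ≃ₐ[K] AlgebraicClosure K,
      ∀ η, η ^ q = 1 → γ η = η ^ u := by
  have : CharZero K := algebraRat.charZero K
  have : CharZero (AlgebraicClosure K) := charZero_of_injective_algebraMap
    (algebraMap K (AlgebraicClosure K)).injective
  have : Algebra.IsIntegral ℚ K := IsCyclotomicExtension.integral {m} ℚ K
  have : Algebra.IsAlgebraic ℚ (AlgebraicClosure K) := Algebra.IsAlgebraic.trans ℚ K _
  have : Normal ℚ (AlgebraicClosure K) :=
    normal_iff.mpr fun x => ⟨(Algebra.IsAlgebraic.isAlgebraic x).isIntegral, IsAlgClosed.splits _⟩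
  have hN : m.lcm q ≠ 0 := Nat.lcm_ne_zero (NeZero.ne m) hq
  have huN : u.Coprime (m.lcm q) := by
    have h1 : u.Coprime m := by
      have := hum.gcd_eq
      simpa using this
    exact Nat.Coprime.of_dvd_right (Nat.lcm_dvd_mul m q) (h1.mul_right huq)
  have : NeZero (m.lcm q) := ⟨hN⟩
  obtain ⟨ξ, hξ⟩ := HasEnoughRootsOfUnity.exists_primitiveRoot (AlgebraicClosure K) (m.lcm q)
  have hirr := cyclotomic.irreducible_rat (Nat.pos_of_ne_zero hN)
  obtain ⟨σ, hσ⟩ := IsConjRoot.exists_algEquiv (K := ℚ) (x := ξ ^ u) (y := ξ) (by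
    rw [IsConjRoot, ← hξ.minpoly_eq_cyclotomic_of_irreducible hirr,
      ← (hξ.pow_of_coprime u huN).minpoly_eq_cyclotomic_of_irreducible hirr])
  have hσ' : ∀ η, η ^ (m.lcm q) = 1 → σ η = η ^ u := by
    intro η hη
    obtain ⟨i, -, rfl⟩ := hξ.eq_pow_of_pow_eq_one hη
    rw [map_pow, hσ, ← pow_mul, ← pow_mul, mul_comm]
  have hζ := IsCyclotomicExtension.zeta_spec m ℚ K
  have hfix : (σ : AlgebraicClosure K →ₐ[ℚ] AlgebraicClosure K).comp
      (IsScalarTower.toAlgHom ℚ K (AlgebraicClosure K)) =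
      IsScalarTower.toAlgHom ℚ K (AlgebraicClosure K) := by
    refine (hζ.powerBasis ℚ).algHom_ext ?_
    rw [IsPrimitiveRoot.powerBasis_gen]
    change σ (algebraMap K _ _) = algebraMap K _ _
    obtain ⟨c, hc⟩ := Nat.dvd_lcm_left m q
    have h1 : algebraMap K (AlgebraicClosure K) (IsCyclotomicExtension.zeta m ℚ K) ^ m = 1 := by
      rw [← map_pow, hζ.pow_eq_one, map_one]
    rw [hσ' _ (by rw [hc, pow_mul, h1, one_pow])]
    exact pow_eq_pow_of_modEq hum h1 |>.trans (pow_one _)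
  refine ⟨AlgEquiv.ofRingEquiv (f := σ.toRingEquiv) fun x => DFunLike.congr_fun hfix x,
    fun η hη => hσ' η ?_⟩
  obtain ⟨c, hc⟩ := Nat.dvd_lcm_right m q
  rw [hc, pow_mul, hη, one_pow]

/-- The Chinese remainder theorem makes u a generator of the cyclic group (ℤ/p^E)^× and 1 modulo m.
-/
theorem exists_generator_modEq_one {p E m : ℕ} (hp : p.Prime) (hp2 : p ≠ 2) (hpm : ¬ p ∣ m) :
    ∃ u : ℕ, u ≡ 1 [MOD m] ∧ u.Coprime (p ^ E) ∧
      ∀ k, ((p ^ E : ℕ) : ℤ) ∣ (u : ℤ) ^ k - 1 → (p ^ E).totient ∣ k := by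
  have : Fact p.Prime := ⟨hp⟩
  have hcyc := ZMod.isCyclic_units_of_prime_pow p hp hp2 E
  have : NeZero (p ^ E) := ⟨(pow_pos hp.pos E).ne'⟩
  obtain ⟨g, hg⟩ := IsCyclic.exists_ofOrder_eq_natCard (α := (ZMod (p ^ E))ˣ)
  rw [Nat.card_eq_fintype_card, ZMod.card_units_eq_totient] at hg
  have hcop : m.Coprime (p ^ E) := (Nat.Coprime.pow_left E ((hp.coprime_iff_not_dvd).mpr hpm)).symm
  obtain ⟨u, hu1, hu2⟩ := Nat.chineseRemainder hcop 1 (g : ZMod (p ^ E)).val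
  have hug : ((u : ℕ) : ZMod (p ^ E)) = g := by
    rw [← ZMod.natCast_eq_natCast_iff] at hu2
    rw [hu2, ZMod.natCast_zmod_val]
  refine ⟨u, hu1, ?_, fun k hk => ?_⟩
  · rw [← ZMod.isUnit_iff_coprime, hug]
    exact g.isUnit
  · rw [← ZMod.intCast_zmod_eq_zero_iff_dvd] at hk
    push_cast at hk
    rw [hug, sub_eq_zero] at hk
    rw [← hg]
    exact orderOf_dvd_of_pow_eq_one (Units.ext (by simpa using hk))

/-- The lcm condition alone would let p^(E-1) and p - 1 divide different exponents. By the product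
condition, if p fails to divide one of u^A - 1, u^B - 1, then p^E divides the other; if p divides
both, then p - 1 divides both A and B. -/
theorem totient_dvd_or_dvd {p E u A B : ℕ} (hp : p.Prime) (hE : E ≠ 0) (hA : A ≠ 0) (hB : B ≠ 0)
    (hu : ∀ k, ((p ^ E : ℕ) : ℤ) ∣ (u : ℤ) ^ k - 1 → (p ^ E).totient ∣ k)
    (hlcm : ((p ^ E : ℕ) : ℤ) ∣ (u : ℤ) ^ (A.lcm B) - 1)
    (hmul : ((p ^ E : ℕ) : ℤ) ∣ ((u : ℤ) ^ A - 1) * ((u : ℤ) ^ B - 1)) :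
    (p ^ E).totient ∣ A ∨ (p ^ E).totient ∣ B := by
  have hpZ : Prime (p : ℤ) := Nat.prime_iff_prime_int.mp hp
  by_cases hpA : (p : ℤ) ∣ (u : ℤ) ^ A - 1
  swap
  · rw [Nat.cast_pow] at hmul
    exact Or.inr (hu B (by rw [Nat.cast_pow]; exact hpZ.pow_dvd_of_dvd_mul_left E hpA hmul))
  by_cases hpB : (p : ℤ) ∣ (u : ℤ) ^ B - 1
  swap
  · rw [Nat.cast_pow] at hmul
    exact Or.inl (hu A (by rw [Nat.cast_pow]; exact hpZ.pow_dvd_of_dvd_mul_right E hpB hmul))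
  obtain ⟨e, rfl⟩ := Nat.exists_eq_succ_of_ne_zero hE
  have htot : (p ^ (e + 1)).totient = p ^ e * (p - 1) := by
    rw [Nat.totient_prime_pow_succ hp]
  have hred : ∀ k, (p : ℤ) ∣ (u : ℤ) ^ k - 1 → p - 1 ∣ k := by
    intro k hk
    have h1 := dvd_sub_pow_of_dvd_sub hk e
    rw [one_pow, ← pow_mul] at h1
    have h2 := hu (k * p ^ e) (by exact_mod_cast h1)
    rw [Nat.succ_eq_add_one, htot, mul_comm k] at h2
    exact Nat.dvd_of_mul_dvd_mul_left (pow_pos hp.pos e) h2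
  have hcop : (p ^ e).Coprime (p - 1) := Nat.Coprime.pow_left e
    ((Nat.coprime_self_sub_right hp.one_le).mpr (Nat.coprime_one_right p))
  rw [Nat.succ_eq_add_one, htot] at hu ⊢
  refine (pow_dvd_or_pow_dvd_of_dvd_lcm hp hA hB
    ((Dvd.intro _ rfl).trans (hu _ hlcm))).imp (fun h => ?_) (fun h => ?_)
  · exact hcop.mul_dvd_of_dvd_of_dvd h (hred A hpA)
  · exact hcop.mul_dvd_of_dvd_of_dvd h (hred B hpB)

section

variable (m : ℕ) [NeZero m] {K : Type*} [Field K] [Algebra ℚ K] [IsCyclotomicExtension {m} ℚ K]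

/-- If `x` and `y` have degree at most `n` over `K` and `x ^ c = η * y ^ c` with `η` a root of
unity of order `p ^ E`, then `E` is at most the exponent of `p` in the bound. -/
theorem le_expo_of_isPrimitiveRoot {m' : ℕ} (hm' : m' ≠ 0) (hmm' : m ∣ m') (h2 : 2 ∣ m') {n : ℕ}
    (hn : n ≠ 0)
    {f g : K[X]} (hf : f ≠ 0) (hg : g ≠ 0) (hfn : f.natDegree ≤ n) (hgn : g.natDegree ≤ n)
    {x y η : AlgebraicClosure K} (hx : aeval x f = 0) (hy : aeval y g = 0) (hy0 : y ≠ 0)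
    {c p E : ℕ} (hp : p.Prime) (hη : IsPrimitiveRoot η (p ^ E)) (hxy : x ^ c = η * y ^ c) :
    E ≤ VirtualPeriod.expo m' n p := by
  have hq : p ^ E ≠ 0 := (pow_pos hp.pos E).ne'
  have key : ∀ u : ℕ, u ≡ 1 [MOD m'] → u.Coprime (p ^ E) → ∃ A B, A ≠ 0 ∧ B ≠ 0 ∧ A ≤ n ∧ B ≤ n ∧
      ((p ^ E : ℕ) : ℤ) ∣ (u : ℤ) ^ (A.lcm B) - 1 ∧
      ((p ^ E : ℕ) : ℤ) ∣ ((u : ℤ) ^ A - 1) * ((u : ℤ) ^ B - 1) := by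
    intro u hu hup
    obtain ⟨γ, hγ⟩ := exists_algEquiv_forall_root_of_unity m (K := K) hq (hu.of_dvd hmm') hup
    obtain ⟨A, hA0, hAn, hA⟩ := exists_algEquiv_pow_eq_self hf hfn hx γ
    obtain ⟨B, hB0, hBn, hB⟩ := exists_algEquiv_pow_eq_self hg hgn hy γ
    have hA' : (γ ^ A) (x ^ c) = x ^ c := by rw [map_pow, hA]
    have hB' : (γ ^ B) (y ^ c) = y ^ c := by rw [map_pow, hB]
    have hγη := hγ η hη.pow_eq_one
    exact ⟨A, B, hA0.ne', hB0.ne', hAn, hBn,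
      dvd_pow_lcm_sub_one hη hq hγη (pow_ne_zero c hy0) hxy hA' hB',
      dvd_pow_sub_one_mul_pow_sub_one hη hq hγη (pow_ne_zero c hy0) hxy hA' hB'⟩
  -- For p dividing m'' the choice is u = 1 + m''; the p-part of its order modulo p^E must divide A
  -- or B.
  have ramified : ∀ m'' : ℕ, m'' ≠ 0 → m' ∣ m'' → p ∣ m'' → (p = 2 → 4 ∣ m'') →
      E ≤ padicValNat p m'' + Nat.log p n := by
    intro m'' h0 hd hpd h4
    obtain ⟨A, B, hA0, hB0, hA, hB, hlcm, -⟩ := key (1 + m'')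
      ((Nat.modEq_iff_dvd' (Nat.le_add_right 1 m'')).mpr (by simpa using hd)).symm
      (Nat.Coprime.pow_right E (((Nat.Prime.coprime_iff_not_dvd hp).mpr (fun h => by
        have := (Nat.dvd_add_left hpd).mp h
        exact hp.one_lt.ne' (Nat.dvd_one.mp this))).symm))
    have h1 := dvd_of_pow_dvd_one_add_pow_sub_one hp h0 hpd h4 hlcm
    have h2 : p ^ (E - padicValNat p m'') ≤ n :=
      (pow_dvd_or_pow_dvd_of_dvd_lcm hp hA0 hB0 h1).elim
        (fun h => (Nat.le_of_dvd (Nat.pos_of_ne_zero hA0) h).trans hA)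
        (fun h => (Nat.le_of_dvd (Nat.pos_of_ne_zero hB0) h).trans hB)
    have h3 := Nat.le_log_of_pow_le hp.one_lt h2
    omega
  have hpf : Fact p.Prime := ⟨hp⟩
  unfold VirtualPeriod.expo
  split_ifs with h1 h3 h4
  · obtain ⟨rfl, hv⟩ := h3
    -- Here 4 does not divide m'; doubling m' repairs this at the cost of one more factor 2, the
    -- source of the 2 in e_2.
    have := ramified (2 * m') (by omega) (Dvd.intro_left _ rfl) (Dvd.intro _ rfl)
      (fun _ => Nat.mul_dvd_mul_left 2 h2)
    rwa [padicValNat.mul (by norm_num) hm', padicValNat_self, hv] at this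
  · refine ramified m' hm' dvd_rfl h1 ?_
    rintro rfl
    have h5 : padicValNat 2 m' ≠ 0 := (dvd_iff_padicValNat_ne_zero hm').mp h1
    have h6 : padicValNat 2 m' ≠ 1 := fun h => h3 ⟨rfl, h⟩
    exact (show (4 : ℕ) = 2 ^ 2 by norm_num) ▸ (padicValNat_dvd_iff_le hm').mpr (by omega)
  -- For p not dividing m', a generator u forces φ(p^E) = p^(E-1) (p - 1) ≤ n.
  all_goals
    by_contra! hE
    have hp2 : p ≠ 2 := by rintro rfl; exact h1 h2
    obtain ⟨u, hu1, hu2, hu3⟩ := exists_generator_modEq_one (E := E) hp hp2 h1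
    obtain ⟨A, B, hA0, hB0, hA, hB, hlcm, hmul⟩ := key u hu1 hu2
    have h5 : (p ^ E).totient ≤ n :=
      (totient_dvd_or_dvd hp (by omega) hA0 hB0 hu3 hlcm hmul).elim
        (fun h => (Nat.le_of_dvd (Nat.pos_of_ne_zero hA0) h).trans hA)
        (fun h => (Nat.le_of_dvd (Nat.pos_of_ne_zero hB0) h).trans hB)
    obtain ⟨e, rfl⟩ := Nat.exists_eq_succ_of_ne_zero (show E ≠ 0 by omega)
    rw [Nat.totient_prime_pow_succ hp] at h5
    have hp1 : 0 < p - 1 := Nat.sub_pos_of_lt hp.one_lt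
  · have h6 := Nat.le_log_of_pow_le hp.one_lt ((Nat.le_div_iff_mul_le hp1).mpr h5)
    omega
  · have h6 : p - 1 ≤ n := (Nat.le_mul_of_pos_left _ (pow_pos hp.pos e)).trans h5
    omega

/-- If lcm(l, m) = m r, comparing degrees gives φ(m) φ(r) ≤ φ(m r) ≤ φ(m), so r ≤ 2; for even m,
φ(2m) = 2 φ(m) excludes r = 2. -/
theorem dvd_ite_of_isPrimitiveRoot {ζ : K} {l : ℕ} (hζ : IsPrimitiveRoot ζ l)
    (hl : l ≠ 0) : l ∣ if 2 ∣ m then m else 2 * m := by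
  have hm := NeZero.pos m
  have : FiniteDimensional ℚ K := IsCyclotomicExtension.finiteDimensional {m} ℚ K
  have key := hζ.lcm_totient_le_finrank (IsCyclotomicExtension.zeta_spec m ℚ K)
    (cyclotomic.irreducible_rat (Nat.lcm_pos (Nat.pos_of_ne_zero hl) hm))
  rw [IsCyclotomicExtension.finrank K (cyclotomic.irreducible_rat hm)] at key
  obtain ⟨r, hr⟩ := Nat.dvd_lcm_right l m
  have hr0 : r ≠ 0 := by
    rintro rfl
    exact Nat.lcm_ne_zero hl hm.ne' hr
  have hle := (Nat.totient_super_multiplicative m r).trans (hr ▸ key)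
  have hr1 : r.totient ≤ 1 := by
    have := Nat.totient_pos.mpr hm
    by_contra! h
    nlinarith
  have hlr : l ∣ m * r := hr ▸ Nat.dvd_lcm_left l m
  rcases (Nat.dvd_prime Nat.prime_two).mp
    (Nat.dvd_two_of_totient_le_one (Nat.pos_of_ne_zero hr0) hr1) with rfl | rfl
  · rw [mul_one] at hlr
    split_ifs
    · exact hlr
    · exact hlr.mul_left 2
  · split_ifs with h
    · rw [hr, mul_comm, Nat.totient_mul_of_prime_of_dvd Nat.prime_two h] at key
      have := Nat.totient_pos.mpr hm
      omega
    · rwa [mul_comm] at hlr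

theorem mem_range_algebraMap_of_natDegree_le_one {K L : Type*} [Field K] [Field L] [Algebra K L]
    {f : K[X]} (hf : f ≠ 0) (h : f.natDegree ≤ 1) {x : L} (hx : aeval x f = 0) :
    ∃ z, algebraMap K L z = x := by
  have h1 : (minpoly K x).natDegree = 1 := by
    have hint : IsIntegral K x := IsAlgebraic.isIntegral ⟨f, hf, hx⟩
    have h2 := (natDegree_le_of_dvd (minpoly.dvd K x hx) hf).trans h
    have h3 := minpoly.natDegree_pos hint
    omega
  exact minpoly.natDegree_eq_one_iff.mp h1

/-- If the ratio of two elements of degree at most `n` over the `m`-th cyclotomic field is a root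
of unity, then its order divides `bound m n`. -/
theorem dvd_bound_of_isPrimitiveRoot {n : ℕ} (hn : n ≠ 0) {f g : K[X]} (hf : f ≠ 0) (hg : g ≠ 0)
    (hfn : f.natDegree ≤ n) (hgn : g.natDegree ≤ n) {x y ζ : AlgebraicClosure K}
    (hx : aeval x f = 0) (hy : aeval y g = 0) (hy0 : y ≠ 0) (hxy : x = ζ * y) {l : ℕ} (hl : l ≠ 0)
    (hζ : IsPrimitiveRoot ζ l) : l ∣ VirtualPeriod.bound m n := by
  obtain ⟨m', hm'⟩ : ∃ m', m' = if 2 ∣ m then m else 2 * m := ⟨_, rfl⟩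
  have hb : VirtualPeriod.bound m n = VirtualPeriod.boundEven m' n := by
    rw [VirtualPeriod.bound, hm']
    split_ifs <;> rfl
  have hm0 : m' ≠ 0 := by
    have := NeZero.ne m
    rw [hm']
    split_ifs <;> omega
  have hmm' : m ∣ m' := by
    rw [hm']
    split_ifs
    · exact dvd_rfl
    · exact Dvd.intro_left _ rfl
  have h2 : 2 ∣ m' := by
    rw [hm']
    split_ifs with h
    · exact h
    · exact Dvd.intro _ rfl
  rw [hb, VirtualPeriod.boundEven]
  split_ifs with h1
  · subst h1
    obtain ⟨a, rfl⟩ := mem_range_algebraMap_of_natDegree_le_one hf hfn hx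
    obtain ⟨b, rfl⟩ := mem_range_algebraMap_of_natDegree_le_one hg hgn hy
    have hζab : ζ = algebraMap K _ (a / b) := by
      rw [map_div₀, hxy, mul_div_cancel_right₀ _ hy0]
    rw [hζab] at hζ
    rw [hm']
    exact dvd_ite_of_isPrimitiveRoot m
      (hζ.of_map_of_injective (algebraMap K (AlgebraicClosure K)).injective) hl
  · refine (Nat.dvd_iff_prime_pow_dvd_dvd _ _).mpr fun p E hp hpE => ?_
    have hE : E ≤ VirtualPeriod.expo m' n p := by
      obtain ⟨c, hc⟩ := hpE
      -- With c = l / p^E, the power ζ^c isolates the p-part of ζ.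
      refine le_expo_of_isPrimitiveRoot m hm0 hmm' h2 hn hf hg hfn hgn hx hy hy0 (c := c) hp
        (hζ.pow (Nat.pos_of_ne_zero hl) (by rw [hc, mul_comm])) ?_
      rw [hxy, mul_pow]
    refine (pow_dvd_pow p hE).trans ?_
    by_cases he : VirtualPeriod.expo m' n p = 0
    · rw [he, pow_zero]
      exact one_dvd _
    · refine Finset.dvd_prod_of_mem (fun p => p ^ VirtualPeriod.expo m' n p) ?_
      rw [Finset.mem_filter, Finset.mem_range]
      refine ⟨?_, hp⟩
      by_cases hpm : p ∣ m'
      · have := Nat.le_of_dvd (Nat.pos_of_ne_zero hm0) hpm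
        omega
      · by_contra! hlt
        apply he
        rw [VirtualPeriod.expo, if_neg hpm, if_neg (by omega)]

theorem bound_pos (n : ℕ) : 0 < VirtualPeriod.bound m n := by
  have h : ∀ m', 0 < m' → 0 < VirtualPeriod.boundEven m' n := by
    intro m' hm'
    rw [VirtualPeriod.boundEven]
    split_ifs
    · exact hm'
    · exact Finset.prod_pos fun p hp => pow_pos (Finset.mem_filter.mp hp).2.pos _
  have := NeZero.pos m
  rw [VirtualPeriod.bound]
  split_ifs
  · exact h m this
  · exact h (2 * m) (by omega)

theorem pow_bound_eq_pow_bound {n : ℕ} (hn : n ≠ 0) {f g : K[X]} (hf : f ≠ 0) (hg : g ≠ 0)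
    (hfn : f.natDegree ≤ n) (hgn : g.natDegree ≤ n) {x y : AlgebraicClosure K}
    (hx : aeval x f = 0) (hy : aeval y g = 0) (hy0 : y ≠ 0) {j : ℕ} (hj : 0 < j)
    (hxy : x ^ j = y ^ j) : x ^ VirtualPeriod.bound m n = y ^ VirtualPeriod.bound m n := by
  have h1 : (x / y) ^ j = 1 := by rw [div_pow, hxy, div_self (pow_ne_zero j hy0)]
  have h2 : orderOf (x / y) ≠ 0 := (orderOf_pos_iff.mpr
    (isOfFinOrder_iff_pow_eq_one.mpr ⟨j, hj, h1⟩)).ne'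
  have h3 := dvd_bound_of_isPrimitiveRoot m hn hf hg hfn hgn hx hy hy0
    (div_mul_cancel₀ x hy0).symm h2 (IsPrimitiveRoot.orderOf _)
  have h4 := orderOf_dvd_iff_pow_eq_one.mp h3
  rwa [div_pow, div_eq_one_iff_eq (pow_ne_zero _ hy0)] at h4

end

/-! ### Zeros and Galois-fixed terms of a linear recurrence sequence. -/

theorem annihilatesSeq_charPoly {K : Type*} [Field K] {E : LinearRecurrence K} {a : ℕ → K}
    (h : E.IsSolution a) : AnnihilatesSeq E.charPoly a := by
  refine annihilatesSeq_of_forall_X_pow fun k => ?_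
  have h1 : ∀ i c, seqFunctional a (monomial i c * X ^ k) = a (i + k) * c := by
    intro i c
    rw [monomial_mul_X_pow, seqFunctional_monomial]
  rw [LinearRecurrence.charPoly, sub_mul, Finset.sum_mul, map_sub, map_sum]
  simp only [h1]
  rw [mul_one, add_comm, h k, sub_eq_zero]
  exact Finset.sum_congr rfl fun i _ => by rw [mul_comm, add_comm]

theorem charPoly_coeff_zero_ne_zero {K : Type*} [Field K] {n : ℕ} (hn : 1 ≤ n) {c : ℕ → K}
    (hc : c n ≠ 0) :
    (LinearRecurrence.charPoly ⟨n, fun i : Fin n => c (n - (i : ℕ))⟩).coeff 0 ≠ 0 := by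
  rw [LinearRecurrence.charPoly, coeff_sub, finsetSum_coeff]
  simp only [coeff_monomial]
  rw [if_neg (by change n ≠ 0; omega), Finset.sum_eq_single (⟨0, hn⟩ : Fin n)]
  · simpa using hc
  · intro i _ hi
    rw [if_neg fun h => hi (Fin.ext h)]
  · exact fun h => (h (Finset.mem_univ _)).elim

theorem ne_zero_of_aeval_eq_zero {K L : Type*} [Field K] [Field L] [Algebra K L] {f : K[X]}
    (h0 : f.coeff 0 ≠ 0) {x : L} (hx : aeval x f = 0) : x ≠ 0 := by
  rintro rfl
  rw [aeval_def, eval₂_at_zero, map_eq_zero] at hx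
  exact h0 hx

section

variable (m : ℕ) [NeZero m] {K : Type*} [Field K] [Algebra ℚ K] [IsCyclotomicExtension {m} ℚ K]
  {n : ℕ} {a : ℕ → K}

theorem finite_zeros_or_forall_modEq (ha : VirtualPeriod.IsLinearRecurrenceSeq n a) (i : ℕ) :
    {k : ℕ | a k = 0 ∧ k ≡ i [MOD VirtualPeriod.bound m n]}.Finite ∨
      ∀ k, k ≡ i [MOD VirtualPeriod.bound m n] → a k = 0 := by
  obtain ⟨hn, c, hc, hsol⟩ := ha
  have h0 := charPoly_coeff_zero_ne_zero hn hc
  have hF := LinearRecurrence.charPoly_monic ⟨n, fun i : Fin n => c (n - (i : ℕ))⟩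
  have hdeg := natDegree_eq_of_degree_eq_some
    (LinearRecurrence.charPoly_degree_eq_order ⟨n, fun i : Fin n => c (n - (i : ℕ))⟩)
  exact (annihilatesSeq_charPoly hsol).finite_or_forall_modEq m hF h0 (bound_pos m n)
    (fun x y j hx hy hj hxy => pow_bound_eq_pow_bound m (Nat.one_le_iff_ne_zero.mp hn) hF.ne_zero hF.ne_zero hdeg.le
      hdeg.le hx hy (ne_zero_of_aeval_eq_zero h0 hy) hj hxy) i

theorem finite_fixed_or_forall_modEq (ha : VirtualPeriod.IsLinearRecurrenceSeq n a)
    (σ : K ≃ₐ[ℚ] K) (i : ℕ) :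
    {k : ℕ | σ (a k) = a k ∧ k ≡ i [MOD VirtualPeriod.bound m n]}.Finite ∨
      ∀ k, k ≡ i [MOD VirtualPeriod.bound m n] → σ (a k) = a k := by
  obtain ⟨hn, c, hc, hsol⟩ := ha
  set F := LinearRecurrence.charPoly ⟨n, fun i : Fin n => c (n - (i : ℕ))⟩ with hFdef
  have h0 : F.coeff 0 ≠ 0 := charPoly_coeff_zero_ne_zero hn hc
  have hF : F.Monic := LinearRecurrence.charPoly_monic _
  have hdeg : F.natDegree = n := natDegree_eq_of_degree_eq_some
    (LinearRecurrence.charPoly_degree_eq_order _)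
  let G := F.map (σ : K →+* K)
  have hG : G.Monic := hF.map _
  have hG0 : G.coeff 0 ≠ 0 := by
    rw [coeff_map]
    exact (_root_.map_ne_zero _).mpr h0
  have hGdeg : G.natDegree ≤ n := natDegree_map_le.trans hdeg.le
  have hann : AnnihilatesSeq F a := annihilatesSeq_charPoly hsol
  -- The product has degree up to 2n, but only the degree of the factor containing a given root
  -- enters the bound.
  have hann' : AnnihilatesSeq (G * F) fun k => σ (a k) - a k :=
    (hann.map (σ : K →+* K)).sub hann
  have hroot : ∀ x : AlgebraicClosure K, aeval x (G * F) = 0 → x ≠ 0 ∧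
      ∃ f : K[X], f ≠ 0 ∧ f.natDegree ≤ n ∧ aeval x f = 0 := by
    intro x hx
    rw [map_mul, mul_eq_zero] at hx
    rcases hx with hx | hx
    · exact ⟨ne_zero_of_aeval_eq_zero hG0 hx, G, hG.ne_zero, hGdeg, hx⟩
    · exact ⟨ne_zero_of_aeval_eq_zero h0 hx, F, hF.ne_zero, hdeg.le, hx⟩
  have := hann'.finite_or_forall_modEq m (hG.mul hF)
    (by rw [mul_coeff_zero]; exact mul_ne_zero hG0 h0) (bound_pos m n)
    (fun x y j hx hy hj hxy => by
      obtain ⟨-, f, hf, hfn, hfx⟩ := hroot x hx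
      obtain ⟨hy0, g, hg, hgn, hgy⟩ := hroot y hy
      exact pow_bound_eq_pow_bound m (by omega) hf hg hfn hgn hfx hgy hy0 hj hxy) i
  simpa only [sub_eq_zero] using this

end

/-! ### Generated fields, minimal periods and the conclusion. -/

theorem adjoin_simple_le_iff_forall_fixed {F E : Type*} [Field F] [Field E] [Algebra F E]
    [FiniteDimensional F E] [IsGalois F E] (x y : E) :
    IntermediateField.adjoin F {x} ≤ IntermediateField.adjoin F {y} ↔
      ∀ σ : E ≃ₐ[F] E, σ y = y → σ x = x := by
  have hfix : ∀ (σ : E ≃ₐ[F] E) (z : E),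
      σ ∈ (IntermediateField.adjoin F {z}).fixingSubgroup ↔ σ z = z := by
    intro σ z
    refine ⟨fun h => (IntermediateField.mem_fixingSubgroup_iff _ σ).mp h z
      (IntermediateField.mem_adjoin_simple_self F z), fun h => ?_⟩
    have h1 : IntermediateField.adjoin F {z} ≤
        IntermediateField.fixedField (MulAction.stabilizer (E ≃ₐ[F] E) z) := by
      rw [IntermediateField.adjoin_simple_le_iff, IntermediateField.mem_fixedField_iff]
      exact fun τ hτ => hτ
    exact IntermediateField.le_iff_le _ _ |>.mp h1 h
  constructor
  · intro h σ hσ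
    exact (hfix σ x).mp (IntermediateField.fixingSubgroup_antitone h ((hfix σ y).mpr hσ))
  · intro h
    rw [← IsGalois.fixedField_fixingSubgroup (IntermediateField.adjoin F {y}),
      IntermediateField.le_iff_le]
    exact fun σ hσ => (hfix σ x).mpr (h σ ((hfix σ y).mp hσ))

theorem eq_add_mul_of_forall_eq_add {α : Type*} {f : ℕ → α} {N r : ℕ}
    (h : ∀ k, N ≤ k → f k = f (k + r)) {k : ℕ} (hk : N ≤ k) (j : ℕ) : f k = f (k + r * j) := by
  induction j with
  | zero => rfl
  | succ j ih => rw [ih, h _ (hk.trans (Nat.le_add_right _ _)), mul_add, mul_one, add_assoc]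

theorem eq_of_modEq_of_forall_eq_add {α : Type*} {f : ℕ → α} {N r : ℕ}
    (h : ∀ k, N ≤ k → f k = f (k + r)) {k l : ℕ} (hk : N ≤ k) (hl : N ≤ l)
    (hkl : k ≡ l [MOD r]) : f k = f l := by
  have aux : ∀ k l, N ≤ k → k ≤ l → k ≡ l [MOD r] → f k = f l := by
    intro k l hk hle hkl
    obtain ⟨j, hj⟩ := (Nat.modEq_iff_dvd' hle).mp hkl
    rw [eq_add_mul_of_forall_eq_add h hk j, ← hj, Nat.add_sub_cancel' hle]
  rcases le_total k l with hle | hle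
  · exact aux k l hk hle hkl
  · exact (aux l k hl hle hkl.symm).symm

theorem virtualPeriod_dvd_and_le {α : Type*} [PartialOrder α] {f : ℕ → α} {R N₀ : ℕ} (hR : 0 < R)
    (h : ∀ k k', N₀ ≤ k' → k ≡ k' [MOD R] → f k ≤ f k') :
    VirtualPeriod.IsVirtuallyPeriodic f ∧ VirtualPeriod.virtualPeriod f ∣ R ∧
      ∀ k k', k ≡ k' [MOD VirtualPeriod.virtualPeriod f] →
        VirtualPeriod.prePeriodLength f ≤ k' → f k ≤ f k' := by
  have hR' : ∀ k, N₀ + 1 ≤ k → f k = f (k + R) := by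
    intro k hk
    have hmod : k ≡ k + R [MOD R] := (Nat.add_mod_right k R).symm
    exact le_antisymm (h _ _ (by omega) hmod) (h _ _ (by omega) hmod.symm)
  have hper : VirtualPeriod.IsVirtuallyPeriodic f := ⟨N₀ + 1, R, by omega, hR, hR'⟩
  have hrmem := Nat.sInf_mem
    (s := {r : ℕ | ∃ N : ℕ, 1 ≤ N ∧ 1 ≤ r ∧ ∀ k, N ≤ k → f k = f (k + r)})
    ⟨R, N₀ + 1, by omega, hR, hR'⟩
  have hNmem := Nat.sInf_mem
    (s := {N : ℕ | ∃ r : ℕ, 1 ≤ N ∧ 1 ≤ r ∧ ∀ k, N ≤ k → f k = f (k + r)})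
    ⟨N₀ + 1, R, by omega, hR, hR'⟩
  obtain ⟨N₁, -, hr, hrf⟩ := hrmem
  obtain ⟨r₁, -, hr₁, hNf⟩ := hNmem
  change 1 ≤ VirtualPeriod.virtualPeriod f at hr
  change ∀ k, N₁ ≤ k → f k = f (k + VirtualPeriod.virtualPeriod f) at hrf
  change ∀ k, VirtualPeriod.prePeriodLength f ≤ k → f k = f (k + r₁) at hNf
  have hmin : ∀ s N : ℕ, 1 ≤ s → 1 ≤ N → (∀ k, N ≤ k → f k = f (k + s)) →
      VirtualPeriod.virtualPeriod f ≤ s := fun s N hs hN hf => Nat.sInf_le ⟨N, hN, hs, hf⟩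
  generalize VirtualPeriod.virtualPeriod f = r at *
  generalize VirtualPeriod.prePeriodLength f = N at *
  have hdvd : r ∣ R := by
    -- Otherwise R % r would be a smaller positive eventual period.
    by_contra hdvd
    have hpos : 1 ≤ R % r := Nat.one_le_iff_ne_zero.mpr fun h0 => hdvd (Nat.dvd_of_mod_eq_zero h0)
    have hle := hmin (R % r) (N₀ + N₁ + 1) hpos (by omega) fun k hk => by
      rw [hR' k (by omega)]
      refine eq_of_modEq_of_forall_eq_add hrf (by omega) (by omega) ?_
      exact (Nat.mod_modEq R r).symm.add_left k
    have := Nat.mod_lt R hr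
    omega
  refine ⟨hper, hdvd, fun k k' hkk' hk' => ?_⟩
  have hbig : ∀ c, 1 ≤ c → N₀ + N₁ ≤ c * (N₀ + N₁) := fun c hc => Nat.le_mul_of_pos_left _ hc
  have hmod : ∀ l c, l ≡ l + R * c [MOD R] := fun l c => (Nat.add_mul_mod_self_left l R c).symm
  -- The pre-period length is attained with some period r₁, not assumed equal to r. So both indices
  -- move far out: k by a multiple of R, using monotonicity, and k' by a multiple of r₁; there the
  -- period r identifies the values.
  calc f k ≤ f (k + R * (N₀ + N₁)) :=
        h _ _ (by have := hbig R hR; omega) (hmod _ _)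
    _ = f (k' + R * (r₁ * (N₀ + N₁))) := by
        refine eq_of_modEq_of_forall_eq_add hrf (by have := hbig R hR; omega) ?_ ?_
        · have := hbig (R * r₁) (Nat.mul_pos hR hr₁)
          rw [mul_assoc] at this
          omega
        · exact (((hmod _ _).of_dvd hdvd).symm.trans hkk').trans ((hmod _ _).of_dvd hdvd)
    _ = f k' := by
        rw [mul_left_comm]
        exact (eq_add_mul_of_forall_eq_add hNf hk' _).symm

theorem exists_finset_residues_union_finite {Z : Set ℕ} {R : ℕ} (hR : 0 < R)
    (h : ∀ i, {k : ℕ | k ∈ Z ∧ k ≡ i [MOD R]}.Finite ∨ ∀ k, k ≡ i [MOD R] → k ∈ Z) :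
    ∃ I F : Finset ℕ, Z = (⋃ i ∈ I, {k : ℕ | ∃ t : ℕ, k = i + R * t}) ∪ (F : Set ℕ) := by
  classical
  let I := (Finset.range R).filter fun i => ∀ k, k ≡ i [MOD R] → k ∈ Z
  let J := (Finset.range R).filter fun i => {k : ℕ | k ∈ Z ∧ k ≡ i [MOD R]}.Finite
  have hfin : (⋃ i ∈ J, {k : ℕ | k ∈ Z ∧ k ≡ i [MOD R]}).Finite :=
    J.finite_toSet.biUnion fun i hi => (Finset.mem_filter.mp hi).2
  refine ⟨I, hfin.toFinset, Set.ext fun k => ?_⟩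
  simp only [Set.mem_union, Set.mem_iUnion, Set.Finite.coe_toFinset]
  constructor
  · intro hk
    have hlt := Finset.mem_range.mpr (Nat.mod_lt k hR)
    rcases h (k % R) with h1 | h1
    · exact Or.inr ⟨k % R, Finset.mem_filter.mpr ⟨hlt, h1⟩, hk, (Nat.mod_modEq k R).symm⟩
    · exact Or.inl ⟨k % R, Finset.mem_filter.mpr ⟨hlt, h1⟩, k / R, (Nat.mod_add_div k R).symm⟩
  · rintro (⟨i, hi, t, rfl⟩ | ⟨i, -, hk, -⟩)
    · exact (Finset.mem_filter.mp hi).2 _ (Nat.add_mul_mod_self_left i R t)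
    · exact hk

theorem exists_forall_modEq_adjoin_le (m : ℕ) [NeZero m] {K : Type*} [Field K] [Algebra ℚ K]
    [IsCyclotomicExtension {m} ℚ K] {n : ℕ} {a : ℕ → K}
    (ha : VirtualPeriod.IsLinearRecurrenceSeq n a) :
    ∃ N₀, ∀ k k', N₀ ≤ k' → k ≡ k' [MOD VirtualPeriod.bound m n] →
      IntermediateField.adjoin ℚ {a k} ≤ IntermediateField.adjoin ℚ {a k'} := by
  have : FiniteDimensional ℚ K := IsCyclotomicExtension.finiteDimensional {m} ℚ K
  have : IsGalois ℚ K := IsCyclotomicExtension.isGalois {m} ℚ K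
  set R := VirtualPeriod.bound m n with hRdef
  have hR : 0 < R := bound_pos m n
  -- Each of the finitely many pairs (σ, class modulo R) contributes finitely many exceptions.
  -- Beyond them, σ fixing a k fixes its whole class, small indices included.
  have hfin : {k : ℕ | ∃ σ : K ≃ₐ[ℚ] K, σ (a k) = a k ∧
      ¬ ∀ l, l ≡ k [MOD R] → σ (a l) = a l}.Finite := by
    have : (⋃ σ : K ≃ₐ[ℚ] K, ⋃ i ∈ Finset.range R, {k : ℕ | (σ (a k) = a k ∧ k ≡ i [MOD R]) ∧
        ¬ ∀ l, l ≡ i [MOD R] → σ (a l) = a l}).Finite := by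
      refine Set.finite_iUnion fun σ => (Finset.range R).finite_toSet.biUnion fun i _ => ?_
      rcases finite_fixed_or_forall_modEq m ha σ i with h | h
      · exact h.subset fun k hk => hk.1
      · exact Set.finite_empty.subset fun k hk => hk.2 h
    refine this.subset ?_
    rintro k ⟨σ, h1, h2⟩
    simp only [Set.mem_iUnion]
    refine ⟨σ, k % R, Finset.mem_range.mpr (Nat.mod_lt k hR),
      ⟨h1, (Nat.mod_modEq k R).symm⟩, fun h => h2 fun l hl => ?_⟩
    exact h l (hl.trans (Nat.mod_modEq k R).symm)
  obtain ⟨B, hB⟩ := hfin.bddAbove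
  refine ⟨B + 1, fun k k' hk' hkk' => ?_⟩
  rw [adjoin_simple_le_iff_forall_fixed]
  intro σ hσ
  by_contra hne
  have := hB ⟨σ, hσ, fun h => hne (h k hkk')⟩
  omega

end

theorem mainTheorem1 (m : ℕ) [NeZero m] (K : Type*) [Field K] [Algebra ℚ K]
    [IsCyclotomicExtension {m} ℚ K] (n : ℕ) (a : ℕ → K)
    (ha : VirtualPeriod.IsLinearRecurrenceSeq n a) :
    (∃ s : ℕ, 0 < s ∧ s ∣ VirtualPeriod.bound m n ∧
      ∃ I F : Finset ℕ,
        {k : ℕ | a k = 0} = (⋃ i ∈ I, {k : ℕ | ∃ t : ℕ, k = i + s * t}) ∪ (F : Set ℕ)) ∧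
    VirtualPeriod.IsVirtuallyPeriodic (fun k => IntermediateField.adjoin ℚ {a k}) ∧
    VirtualPeriod.virtualPeriod (fun k => IntermediateField.adjoin ℚ {a k}) ∣
      VirtualPeriod.bound m n ∧
    (∀ k k' : ℕ,
      k ≡ k' [MOD VirtualPeriod.virtualPeriod (fun j => IntermediateField.adjoin ℚ {a j})] →
      VirtualPeriod.prePeriodLength (fun j => IntermediateField.adjoin ℚ {a j}) ≤ k' →
      IntermediateField.adjoin ℚ {a k} ≤ IntermediateField.adjoin ℚ {a k'}) := by
  -- The modulus s may be taken to be R_{m,n} itself.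
  refine ⟨⟨VirtualPeriod.bound m n, bound_pos m n, dvd_rfl,
    exists_finset_residues_union_finite (bound_pos m n) (finite_zeros_or_forall_modEq m ha)⟩, ?_⟩
  obtain ⟨N₀, hN₀⟩ := exists_forall_modEq_adjoin_le m ha
  exact virtualPeriod_dvd_and_le (bound_pos m n) hN₀
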